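/- Setting. Let $G=(V,E)$ be a connected $d$-regular simple graph on $N$ vertices, let $A$ be its normalized adjacency matrix ($A_{uv}=1/d$ on edges, $0$ otherwise), and let the spectral gap $g$ be the difference of the two largest eigenvalues of $A$ (counted with multiplicity). Let the edges at every vertex be labelled bijectively by $\{0,\dots,d-1\}$. On $\mathbb C^d\otimes\mathbb C^V$ put $|H\rangle=\frac1{\sqrt d}\sum_h|h\rangle$, $|\psi_u\rangle=|H\rangle|u\rangle$, $|\Phi_0\rangle=\frac1{\sqrt N}\sum_u|\psi_u\rangle$, and let the flip-flop walk be $W=SC$, with the coin operator $C=2|H\rangle\langle H|\otimes\mathbb I-\mathbb I$ and the shift $S|h,u\rangle=|h',v\rangle$ whenever the edge with label $h$ at $u$ leads to $v$ and has label $h'$ at $v$. Let $T\subseteq V$ be a nonempty set of $M$ marked vertices, with oracle $O=\mathbb I-2\sum_{i\in T}|\psi_i\rangle\langle\psi_i|$. Add an ancilla qubit, and for an angle $\delta$ put $|\delta\rangle=\cos\delta|0\rangle+\sin\delta|1\rangle$, $P_\delta=\sum_{i\in T}|\psi_i\rangle|\delta\rangle\langle\psi_i|\langle\delta|$, $\tilde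 W=W\otimes|0\rangle\langle0|-\mathbb I\otimes|1\rangle\langle1|$, $U_\delta=\tilde W(\mathbb I-2P_\delta)$. Let $\alpha_\delta$ be the smallest $\theta\in(0,\pi]$ such that $e^{i\theta}$ is an eigenvalue of $U_\delta$. One iteration of the search applies to the ancilla the rotation $X_\delta=\begin{pmatrix}\cos\delta&\sin\delta\\-\sin\delta&\cos\delta\end{pmatrix}$, then $O$ controlled by the ancilla state $|0\rangle$, then $X_\delta^\dagger$, then $W$ controlled by the ancilla state $|0\rangle$, then the phase gate $Z=\mathrm{diag}(1,-1)$ on the ancilla; it performs $U_\delta$ with one oracle call. The algorithm runs $Q=\lfloor\pi/(2\alpha_\delta)\rfloor$ iterations from the state $|\Phi_0\rangle|0\rangle$. Theorem. Consider any family of such instances, indexed along a filter (for example, a sequence), with $M=o(N)$ and $\tan\delta=\Theta(1/\sqrt g)$. Then, along the family: (a) eventually the minimum defining $\alpha_\delta$ exists; (b) the success probability $\|P_\delta U_\delta^Q|\Phi_0\rangle|0\rangle\|^2$ is $\Theta(1)$, and so is the probability that a measurement of the vertex register of the final state yields a marked vertex; (c) the oracle complexity of the algorithm, that is its number $Q$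 of oracle calls, is $\Theta\bigl(\sqrt{N/(gM)}\bigr)$. -/

import Mathlib

open Asymptotics Filter
open scoped Kronecker

namespace GraphSearch

/-! ### Graph data -/

/-- A labelling of the edges at every vertex by the `d` coin states. The edge between `u` and
`v = ν u h` is mapped to the coin state `h` at `u` and to `(ν v).symm u` at `v`. -/
abbrev PortLabelling {V : Type*} (G : SimpleGraph V) (d : ℕ) : Type _ :=
  ∀ v : V, Fin d ≃ G.neighborSet v

/-- The normalized adjacency matrix `A` of a `d`-regular graph: `A u v = 1 / d` on edges. -/
noncomputable def normAdj {V : Type*} (G : SimpleGraph V) [DecidableRel G.Adj] (d : ℕ) :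
    Matrix V V ℝ :=
  (1 / (d : ℝ)) • G.adjMatrix ℝ

theorem normAdj_isHermitian {V : Type*} (G : SimpleGraph V) [DecidableRel G.Adj] (d : ℕ) :
    (normAdj G d).IsHermitian := by
  ext u v
  simp [normAdj, Matrix.conjTranspose_apply, SimpleGraph.adjMatrix_apply, G.adj_comm u v]

/-- The spectral gap: the difference of the two largest eigenvalues of the normalized adjacency
matrix, counted with multiplicity (`eigenvalues₀` lists them in decreasing order). On fewer than
two vertices it has no meaning and is set to `0`. -/
noncomputable def spectralGap {V : Type*} [Fintype V] [DecidableEq V] (G : SimpleGraph V)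
    [DecidableRel G.Adj] (d : ℕ) : ℝ :=
  if h : 1 < Fintype.card V then
    (normAdj_isHermitian G d).eigenvalues₀ ⟨0, Nat.lt_of_succ_lt h⟩ -
      (normAdj_isHermitian G d).eigenvalues₀ ⟨1, h⟩
  else 0

/-! ### The flip-flop walk and the oracle on `ℂ^d ⊗ ℂ^V` -/

/-- The flip-flop: the basis state `|h, u⟩` goes to `|g, v⟩`, where the edge with label `h` at `u`
leads to `v` and has the label `g` there. -/
def flipFlop {V : Type*} {G : SimpleGraph V} {d : ℕ} (ν : PortLabelling G d) (x : Fin d × V) :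
    Fin d × V :=
  ((ν (ν x.2 x.1)).symm ⟨x.2, G.adj_symm (ν x.2 x.1).2⟩, (ν x.2 x.1 : V))

/-- The shift operator `S`. -/
def shiftOp {V : Type*} [DecidableEq V] {G : SimpleGraph V} {d : ℕ} (ν : PortLabelling G d) :
    Matrix (Fin d × V) (Fin d × V) ℂ :=
  Matrix.of fun y x => if y = flipFlop ν x then 1 else 0

/-- The uniform coin state `|H⟩`. -/
noncomputable def coinState (d : ℕ) : Fin d → ℂ := fun _ => ((1 / √(d : ℝ) : ℝ) : ℂ)

/-- The Grover coin `C = 2 |H⟩⟨H| ⊗ 1 - 1`. -/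
noncomputable def coinOp (V : Type*) [DecidableEq V] (d : ℕ) :
    Matrix (Fin d × V) (Fin d × V) ℂ :=
  (2 : ℂ) • (Matrix.vecMulVec (coinState d) (star (coinState d)) ⊗ₖ (1 : Matrix V V ℂ)) - 1

/-- The flip-flop walk `W = S C`. -/
noncomputable def walkOp {V : Type*} [Fintype V] [DecidableEq V] {G : SimpleGraph V} {d : ℕ}
    (ν : PortLabelling G d) : Matrix (Fin d × V) (Fin d × V) ℂ :=
  shiftOp ν * coinOp V d

/-- The vertex state `|ψ_u⟩ = |H⟩|u⟩`. -/
noncomputable def vertexState {V : Type*} [DecidableEq V] (d : ℕ) (u : V) : Fin d × V → ℂ :=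
  fun x => coinState d x.1 * (Pi.single u (1 : ℂ) : V → ℂ) x.2

/-- The uniform superposition `|Φ₀⟩ = N^{-1/2} ∑_u |ψ_u⟩`. -/
noncomputable def uniformState (V : Type*) [Fintype V] [DecidableEq V] (d : ℕ) :
    Fin d × V → ℂ :=
  ((1 / √(Fintype.card V : ℝ) : ℝ) : ℂ) • ∑ u : V, vertexState d u

/-- The oracle `O = 1 - 2 ∑_{i ∈ T} |ψ_i⟩⟨ψ_i|`. -/
noncomputable def oracleOp {V : Type*} [DecidableEq V] (d : ℕ) (T : Finset V) :
    Matrix (Fin d × V) (Fin d × V) ℂ :=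
  1 - (2 : ℂ) • ∑ i ∈ T, Matrix.vecMulVec (vertexState d i) (star (vertexState d i))

/-! ### The controlled search on `ℂ² ⊗ ℂ^d ⊗ ℂ^V`, with an ancilla qubit in front -/

/-- `|0⟩⟨0| ⊗ A + |1⟩⟨1| ⊗ B`. -/
def controlled {n : Type*} (A B : Matrix n n ℂ) : Matrix (Fin 2 × n) (Fin 2 × n) ℂ :=
  (!![1, 0; 0, 0] : Matrix (Fin 2) (Fin 2) ℂ) ⊗ₖ A +
    (!![0, 0; 0, 1] : Matrix (Fin 2) (Fin 2) ℂ) ⊗ₖ B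

/-- The ancilla state `|δ⟩ = cos δ |0⟩ + sin δ |1⟩`. -/
noncomputable def ancilla (δ : ℝ) : Fin 2 → ℂ := ![(Real.cos δ : ℂ), (Real.sin δ : ℂ)]

/-- The state `|ψ_{i,δ}⟩ = |δ⟩|ψ_i⟩`. -/
noncomputable def targetState {V : Type*} [DecidableEq V] (d : ℕ) (δ : ℝ) (i : V) :
    Fin 2 × Fin d × V → ℂ :=
  fun x => ancilla δ x.1 * vertexState d i x.2

/-- The projection `P_δ` on the target subspace. -/
noncomputable def targetProj {V : Type*} [DecidableEq V] (d : ℕ) (T : Finset V) (δ : ℝ) :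
    Matrix (Fin 2 × Fin d × V) (Fin 2 × Fin d × V) ℂ :=
  ∑ i ∈ T, Matrix.vecMulVec (targetState d δ i) (star (targetState d δ i))

/-- The search operator `U_δ = W̃ O_δ`, with `W̃ = |0⟩⟨0| ⊗ W - |1⟩⟨1| ⊗ 1` and
`O_δ = 1 - 2 P_δ`. -/
noncomputable def searchOp {V : Type*} [Fintype V] [DecidableEq V] {G : SimpleGraph V} {d : ℕ}
    (ν : PortLabelling G d) (T : Finset V) (δ : ℝ) :
    Matrix (Fin 2 × Fin d × V) (Fin 2 × Fin d × V) ℂ :=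
  controlled (walkOp ν) (-1) * (1 - (2 : ℂ) • targetProj d T δ)

/-- The eigenphases of `U_δ` in `(0, π]`. -/
def eigenphases {V : Type*} [Fintype V] [DecidableEq V] {G : SimpleGraph V} {d : ℕ}
    (ν : PortLabelling G d) (T : Finset V) (δ : ℝ) : Set ℝ :=
  {θ | 0 < θ ∧ θ ≤ Real.pi ∧
    Module.End.HasEigenvalue (Matrix.toLin' (searchOp ν T δ)) (Complex.exp (θ * Complex.I))}

/-- The smallest non-zero eigenphase `α_δ` of `U_δ`. -/
noncomputable def minPhase {V : Type*} [Fintype V] [DecidableEq V] {G : SimpleGraph V} {d : ℕ}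
    (ν : PortLabelling G d) (T : Finset V) (δ : ℝ) : ℝ :=
  sInf (eigenphases ν T δ)

/-! ### The algorithm as a circuit, and its number of oracle calls -/

/-- The gates: the ancilla rotation `X_δ` and its inverse, the phase gate `Z` on the ancilla, and
the oracle and the walk, both controlled by the ancilla state `|0⟩`. -/
inductive Gate where
  | rot
  | oracle
  | rotInv
  | walk
  | phase
  deriving DecidableEq

/-- The rotation `X_δ` of the ancilla qubit. -/
noncomputable def rotation (δ : ℝ) : Matrix (Fin 2) (Fin 2) ℂ :=
  !![(Real.cos δ : ℂ), (Real.sin δ : ℂ); -(Real.sin δ : ℂ), (Real.cos δ : ℂ)]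

/-- The operator which a gate performs. -/
noncomputable def Gate.op {V : Type*} [Fintype V] [DecidableEq V] {G : SimpleGraph V} {d : ℕ}
    (ν : PortLabelling G d) (T : Finset V) (δ : ℝ) :
    Gate → Matrix (Fin 2 × Fin d × V) (Fin 2 × Fin d × V) ℂ
  | .rot => rotation δ ⊗ₖ (1 : Matrix (Fin d × V) (Fin d × V) ℂ)
  | .oracle => controlled (oracleOp d T) 1
  | .rotInv => (rotation δ).conjTranspose ⊗ₖ (1 : Matrix (Fin d × V) (Fin d × V) ℂ)
  | .walk => controlled (walkOp ν) 1
  | .phase => controlled 1 (-1)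

/-- One iteration, in the order of execution. -/
def iteration : List Gate := [.rot, .oracle, .rotInv, .walk, .phase]

/-- The search algorithm: `Q` iterations. -/
def searchCircuit (Q : ℕ) : List Gate := (List.replicate Q iteration).flatten

/-- The number of oracle calls of a circuit. -/
def oracleCalls (c : List Gate) : ℕ := c.count Gate.oracle

/-- The starting state `|Φ₀⟩|0⟩`. -/
noncomputable def startState (V : Type*) [Fintype V] [DecidableEq V] (d : ℕ) :
    Fin 2 × Fin d × V → ℂ :=
  fun x => ancilla 0 x.1 * uniformState V d x.2

/-- The state which a circuit produces from the starting state. -/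
noncomputable def run {V : Type*} [Fintype V] [DecidableEq V] {G : SimpleGraph V} {d : ℕ}
    (ν : PortLabelling G d) (T : Finset V) (δ : ℝ) (c : List Gate) : Fin 2 × Fin d × V → ℂ :=
  c.foldl (fun v k => (k.op ν T δ).mulVec v) (startState V d)

/-- The probability that a state is found in the target subspace, `‖P_δ v‖²`. -/
noncomputable def targetProb {V : Type*} [Fintype V] [DecidableEq V] (d : ℕ) (T : Finset V)
    (δ : ℝ) (v : Fin 2 × Fin d × V → ℂ) : ℝ :=
  ‖WithLp.toLp 2 ((targetProj d T δ).mulVec v)‖ ^ 2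

/-- The probability that a measurement of the vertex register gives a vertex in `T`. -/
noncomputable def findProb {V : Type*} [Fintype V] [DecidableEq V] {d : ℕ} (T : Finset V)
    (v : Fin 2 × Fin d × V → ℂ) : ℝ :=
  ∑ x with x.2.2 ∈ T, ‖v x‖ ^ 2

/-- The number of iterations `⌊π / (2 α_δ)⌋`. -/
noncomputable def numIter {V : Type*} [Fintype V] [DecidableEq V] {G : SimpleGraph V} {d : ℕ}
    (ν : PortLabelling G d) (T : Finset V) (δ : ℝ) : ℕ :=
  ⌊Real.pi / (2 * minPhase ν T δ)⌋₊

/-! ### The circuit performs the search operator -/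

theorem targetProj_eq {V : Type*} [DecidableEq V] (d : ℕ) (T : Finset V) (δ : ℝ) :
    targetProj d T δ = Matrix.vecMulVec (ancilla δ) (star (ancilla δ)) ⊗ₖ
      ∑ i ∈ T, Matrix.vecMulVec (vertexState d i) (star (vertexState d i)) := by
  ext ⟨a, x⟩ ⟨b, y⟩
  simp only [targetProj, Matrix.sum_apply, Matrix.vecMulVec_apply, Matrix.kroneckerMap_apply,
    targetState, Pi.star_apply, star_mul', Finset.mul_sum]
  exact Finset.sum_congr rfl fun i _ => by ring

theorem iteration_op {V : Type*} [Fintype V] [DecidableEq V] {G : SimpleGraph V} {d : ℕ}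
    (ν : PortLabelling G d) (T : Finset V) (δ : ℝ) :
    Gate.op ν T δ .phase * (Gate.op ν T δ .walk * (Gate.op ν T δ .rotInv *
      (Gate.op ν T δ .oracle * Gate.op ν T δ .rot))) = searchOp ν T δ := by
  have h1 : (controlled (1 : Matrix (Fin d × V) (Fin d × V) ℂ) (-1)) * controlled (walkOp ν) 1
      = controlled (walkOp ν) (-1) := by
    have e1 : (!![1, 0; 0, 0] : Matrix (Fin 2) (Fin 2) ℂ) * !![1, 0; 0, 0] = !![1, 0; 0, 0] := by
      ext a b
      fin_cases a <;> fin_cases b <;> simp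
    have e2 : (!![0, 0; 0, 1] : Matrix (Fin 2) (Fin 2) ℂ) * !![0, 0; 0, 1] = !![0, 0; 0, 1] := by
      ext a b
      fin_cases a <;> fin_cases b <;> simp
    have e3 : (!![1, 0; 0, 0] : Matrix (Fin 2) (Fin 2) ℂ) * !![0, 0; 0, 1] = 0 := by
      ext a b
      fin_cases a <;> fin_cases b <;> simp
    have e4 : (!![0, 0; 0, 1] : Matrix (Fin 2) (Fin 2) ℂ) * !![1, 0; 0, 0] = 0 := by
      ext a b
      fin_cases a <;> fin_cases b <;> simp
    simp only [controlled, add_mul, mul_add, ← Matrix.mul_kronecker_mul, e1, e2, e3, e4,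
      Matrix.zero_kronecker, one_mul, mul_one, add_zero, zero_add]
  have hcs : (Real.cos δ : ℂ) * Real.cos δ + Real.sin δ * Real.sin δ = 1 := by
    have := Real.cos_sq_add_sin_sq δ
    rw [← Complex.ofReal_mul, ← Complex.ofReal_mul, ← Complex.ofReal_add, ← sq, ← sq, this]
    simp
  have h2 : (rotation δ).conjTranspose * rotation δ = 1 := by
    ext a b
    fin_cases a <;> fin_cases b <;>
      simp [rotation, Matrix.mul_apply, Fin.sum_univ_two, Complex.conj_ofReal,
        -Complex.ofReal_cos, -Complex.ofReal_sin] <;>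
      first | ring1 | linear_combination hcs
  have h3 : (rotation δ).conjTranspose * ((!![1, 0; 0, 0] : Matrix (Fin 2) (Fin 2) ℂ) *
      rotation δ) = Matrix.vecMulVec (ancilla δ) (star (ancilla δ)) := by
    ext a b
    fin_cases a <;> fin_cases b <;>
      simp [rotation, ancilla, Matrix.mul_apply, Fin.sum_univ_two, Matrix.vecMulVec_apply,
        Complex.conj_ofReal, -Complex.ofReal_cos, -Complex.ofReal_sin]
  have h4 : (!![1, 0; 0, 0] : Matrix (Fin 2) (Fin 2) ℂ) + !![0, 0; 0, 1] = 1 := by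
    ext a b
    fin_cases a <;> fin_cases b <;> simp
  have h5 : ∀ P : Matrix (Fin d × V) (Fin d × V) ℂ, controlled (1 - (2 : ℂ) • P) 1 =
      1 - (2 : ℂ) • ((!![1, 0; 0, 0] : Matrix (Fin 2) (Fin 2) ℂ) ⊗ₖ P) := by
    intro P
    rw [controlled, sub_eq_add_neg, Matrix.kronecker_add, add_right_comm, ← Matrix.add_kronecker,
      h4, Matrix.one_kronecker_one, ← neg_smul, Matrix.kronecker_smul, neg_smul, sub_eq_add_neg]
  rw [← mul_assoc]
  simp only [Gate.op, h1, searchOp]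
  congr 1
  rw [oracleOp, h5, targetProj_eq, sub_mul, mul_sub, one_mul, smul_mul_assoc, mul_smul_comm,
    ← Matrix.mul_kronecker_mul, ← Matrix.mul_kronecker_mul, ← Matrix.mul_kronecker_mul, h2, h3,
    one_mul, mul_one, one_mul, Matrix.one_kronecker_one]

theorem run_searchCircuit {V : Type*} [Fintype V] [DecidableEq V] {G : SimpleGraph V} {d : ℕ}
    (ν : PortLabelling G d) (T : Finset V) (δ : ℝ) (Q : ℕ) :
    run ν T δ (searchCircuit Q) = (searchOp ν T δ ^ Q).mulVec (startState V d) := by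
  have key : ∀ v : Fin 2 × Fin d × V → ℂ,
      iteration.foldl (fun v k => (k.op ν T δ).mulVec v) v = (searchOp ν T δ).mulVec v := by
    intro v
    simp only [iteration, List.foldl, Matrix.mulVec_mulVec, ← iteration_op ν T δ]
  have gen : ∀ v : Fin 2 × Fin d × V → ℂ,
      (searchCircuit Q).foldl (fun v k => (k.op ν T δ).mulVec v) v
        = (searchOp ν T δ ^ Q).mulVec v := by
    induction Q with
    | zero => intro v; simp [searchCircuit]
    | succ n ih =>
      intro v
      have h : searchCircuit (n + 1) = iteration ++ searchCircuit n := by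
        simp [searchCircuit, List.replicate_succ]
      rw [h, List.foldl_append, key, ih, Matrix.mulVec_mulVec, pow_succ]
  exact gen _

end GraphSearch

open GraphSearch

/-!
# Search by the controlled flip-flop walk

Why it works. Put `A` for the normalized adjacency matrix, `g` for its spectral gap, `k = tan² δ`,
`N = |V|` and `M = |T|`. The search operator is a product `U_δ = S̃ R` of two Hermitian
involutions: `S̃ = |0⟩⟨0| ⊗ S - |1⟩⟨1| ⊗ C` (`flipOp`) and the reflection `R` (`coinReflection`)
about the span of the states `|a⟩|ψ_v⟩` minus the target subspace (`searchOp_eq`). For such a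
product, the eigenphases `θ < π` correspond to the eigenvalues `cos θ` of the compression of `S̃`
to the range of `R + 1`. A vector there has amplitudes `p, q : V → ℂ` for the two ancilla states,
tied by `q = -cot δ · p` on `T`, so that the compressed eigenvalue problem becomes
`(1 + A) b = (1 + c) (1 + k⁻¹ 1_T) b` with `c = cos θ`. The right-hand weight is positive and
diagonal, whence the largest `c` is given by a Rayleigh quotient (`exists_ground_state`), and the
smallest eigenphase is exactly `α_δ = arccos c` (`isLeast_eigenphases`).

Let `b` be an eigenvector for this `c` with `∑ b = √N`, and `z` the state with the amplitudes
`p = b` and `q = -cot δ · b` on `T` (`groundVec`). The constant trial vector gives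
`1 - c ≤ 2 M / (k N)`; the spectral gap gives the matching lower bound and shows that `b` is close
to the uniform vector (`ground_state_estimates`). As `k g` is bounded above and below, `1 - c` is
of the order of `g M / N`, hence `α_δ` of the order of `√(g M / N)`, and `z` differs from the
starting state by a vector whose norm is small with `M / N`.

On `z` the powers of `U_δ` are explicit (`sin_smul_pow_mulVec`):
`sin α · U_δ ^ Q z = sin (Q α) S̃ z - sin ((Q - 1) α) z`. The state `z` has no component in the
target subspace, and that of `S̃ z` is proportional to `b` on `T`, whose norm is bounded below by
summing the eigenvalue equation over all vertices. For `Q = ⌊π / (2 α)⌋` the factor `sin (Q α)` is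
bounded below, and `U_δ` being an isometry, the same bound survives for the starting state
(`le_targetProb_of_estimates`, `search_bounds`).
-/

namespace GraphSearch

/-! ### The spectrum of the normalized adjacency matrix -/

section Spectrum

variable {V : Type*} [Fintype V] [DecidableEq V] {G : SimpleGraph V} [DecidableRel G.Adj] {d : ℕ}

omit [Fintype V] [DecidableEq V] in
theorem normAdj_apply (u v : V) : normAdj G d u v = if G.Adj u v then 1 / (d : ℝ) else 0 := by
  simp [normAdj, SimpleGraph.adjMatrix_apply]

omit [Fintype V] [DecidableEq V] in
theorem normAdj_comm (u v : V) : normAdj G d u v = normAdj G d v u := by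
  simp [normAdj_apply, G.adj_comm u v]

omit [Fintype V] [DecidableEq V] in
theorem normAdj_nonneg (u v : V) : 0 ≤ normAdj G d u v := by
  rw [normAdj_apply]; split_ifs <;> positivity

omit [DecidableEq V] in
theorem sum_normAdj (hreg : G.IsRegularOfDegree d) (hd : d ≠ 0) (u : V) :
    ∑ v, normAdj G d u v = 1 := by
  have h : (Finset.univ.filter fun v => G.Adj u v).card = d := by
    rw [← hreg u, ← SimpleGraph.card_neighborFinset_eq_degree]
    congr 1; ext v; simp
  simp only [normAdj_apply, ← Finset.sum_filter, Finset.sum_const, h, nsmul_eq_mul]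
  field_simp

omit [DecidableEq V] in
theorem normAdj_mulVec_one (hreg : G.IsRegularOfDegree d) (hd : d ≠ 0) :
    (normAdj G d).mulVec 1 = 1 := by
  ext u
  simpa [Matrix.mulVec, dotProduct] using sum_normAdj hreg hd u

omit [DecidableEq V] in
/-- The quadratic forms of `1 - A` (for `s = -1`) and of `1 + A` (for `s = 1`) as sums of squares
over the edges. -/
theorem sum_normAdj_mul_sq (hreg : G.IsRegularOfDegree d) (hd : d ≠ 0) (s : ℝ) (p : V → ℝ) :
    ∑ u, ∑ v, normAdj G d u v * (p u + s * p v) ^ 2 =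
      (1 + s ^ 2) * (p ⬝ᵥ p) + 2 * s * (p ⬝ᵥ (normAdj G d).mulVec p) := by
  have h1 : ∑ u, ∑ v, normAdj G d u v * p u ^ 2 = p ⬝ᵥ p := by
    simp only [← Finset.sum_mul, sum_normAdj hreg hd, one_mul, dotProduct, sq]
  have h2 : ∑ u, ∑ v, normAdj G d u v * p v ^ 2 = p ⬝ᵥ p := by
    rw [Finset.sum_comm]
    simp_rw [normAdj_comm (G := G) (d := d)]
    simpa only [normAdj_comm (G := G) (d := d)] using h1
  have h3 : ∑ u, ∑ v, normAdj G d u v * (p u * p v) = p ⬝ᵥ (normAdj G d).mulVec p := by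
    simp only [dotProduct, Matrix.mulVec, Finset.mul_sum]
    exact Finset.sum_congr rfl fun u _ => Finset.sum_congr rfl fun v _ => by ring
  have h4 : ∀ u v, normAdj G d u v * (p u + s * p v) ^ 2 = normAdj G d u v * p u ^ 2 +
      (s ^ 2 * (normAdj G d u v * p v ^ 2) + 2 * s * (normAdj G d u v * (p u * p v))) :=
    fun u v => by ring
  simp only [h4, Finset.sum_add_distrib, ← Finset.mul_sum, h1, h2, h3]
  ring

omit [DecidableEq V] in
theorem dotProduct_normAdj_le (hreg : G.IsRegularOfDegree d) (hd : d ≠ 0) (p : V → ℝ) :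
    p ⬝ᵥ (normAdj G d).mulVec p ≤ p ⬝ᵥ p := by
  have h := sum_normAdj_mul_sq hreg hd (-1) p
  have h0 : 0 ≤ ∑ u, ∑ v, normAdj G d u v * (p u + (-1) * p v) ^ 2 :=
    Finset.sum_nonneg fun u _ => Finset.sum_nonneg fun v _ =>
      mul_nonneg (normAdj_nonneg u v) (sq_nonneg _)
  linarith

omit [DecidableEq V] in
theorem neg_le_dotProduct_normAdj (hreg : G.IsRegularOfDegree d) (hd : d ≠ 0) (p : V → ℝ) :
    -(p ⬝ᵥ p) ≤ p ⬝ᵥ (normAdj G d).mulVec p := by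
  have h := sum_normAdj_mul_sq hreg hd 1 p
  have h0 : 0 ≤ ∑ u, ∑ v, normAdj G d u v * (p u + 1 * p v) ^ 2 :=
    Finset.sum_nonneg fun u _ => Finset.sum_nonneg fun v _ =>
      mul_nonneg (normAdj_nonneg u v) (sq_nonneg _)
  linarith

omit [DecidableEq V] in
/-- On a connected graph the eigenvalue `1` of `A` is simple. -/
theorem eq_of_normAdj_mulVec_eq (hreg : G.IsRegularOfDegree d) (hd : d ≠ 0)
    (hconn : G.Connected) {p : V → ℝ} (hp : (normAdj G d).mulVec p = p) (u v : V) :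
    p u = p v := by
  have h := sum_normAdj_mul_sq hreg hd (-1) p
  rw [hp] at h
  have h0 : ∑ u, ∑ v, normAdj G d u v * (p u + (-1) * p v) ^ 2 = 0 := by rw [h]; ring
  have hadj : ∀ x y, G.Adj x y → p x = p y := by
    intro x y hxy
    have hnn : ∀ u v, 0 ≤ normAdj G d u v * (p u + (-1) * p v) ^ 2 := fun u v =>
      mul_nonneg (normAdj_nonneg u v) (sq_nonneg _)
    have h1 := (Finset.sum_eq_zero_iff_of_nonneg
      (fun u _ => Finset.sum_nonneg fun v _ => hnn u v)).1 h0 x (Finset.mem_univ x)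
    have h2 := (Finset.sum_eq_zero_iff_of_nonneg (fun v _ => hnn x v)).1 h1 y (Finset.mem_univ y)
    rw [normAdj_apply, if_pos hxy] at h2
    have hd' : (d : ℝ) ≠ 0 := Nat.cast_ne_zero.2 hd
    have h3 : p x + (-1) * p y = 0 := by
      rcases mul_eq_zero.1 h2 with h | h
      · exact absurd h (by positivity)
      · exact pow_eq_zero_iff (two_ne_zero) |>.1 h
    linarith
  obtain ⟨w⟩ := hconn.preconnected u v
  induction w with
  | nil => rfl
  | cons hxy _ ih => exact (hadj _ _ hxy).trans ih

omit [DecidableEq V] in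
theorem real_inner_eq_dotProduct (x y : EuclideanSpace ℝ V) : inner ℝ x y = ⇑x ⬝ᵥ ⇑y := by
  simp [PiLp.inner_apply, dotProduct, mul_comm]

/-- The quadratic form of a real symmetric matrix in an orthonormal basis of eigenvectors. -/
theorem dotProduct_mulVec_eq_sum {B : Matrix V V ℝ} (hB : B.IsHermitian) (p : V → ℝ) :
    p ⬝ᵥ B.mulVec p =
      ∑ i, hB.eigenvalues i * (⇑(hB.eigenvectorBasis i) ⬝ᵥ p) ^ 2 := by
  have h := hB.eigenvectorBasis.sum_inner_mul_inner (WithLp.toLp 2 p) (WithLp.toLp 2 (B.mulVec p))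
  simp only [real_inner_eq_dotProduct] at h
  rw [← h]
  refine Finset.sum_congr rfl fun i _ => ?_
  have hBs : B.transpose = B := by
    rwa [Matrix.IsHermitian, Matrix.conjTranspose_eq_transpose_of_trivial] at hB
  have h2 : ⇑(hB.eigenvectorBasis i) ⬝ᵥ B.mulVec p =
      hB.eigenvalues i * (⇑(hB.eigenvectorBasis i) ⬝ᵥ p) := by
    rw [Matrix.dotProduct_mulVec, ← Matrix.mulVec_transpose, hBs, hB.mulVec_eigenvectorBasis,
      smul_dotProduct, smul_eq_mul]
  rw [h2, dotProduct_comm p]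
  ring

theorem dotProduct_self_eq_sum {B : Matrix V V ℝ} (hB : B.IsHermitian) (p : V → ℝ) :
    p ⬝ᵥ p = ∑ i, (⇑(hB.eigenvectorBasis i) ⬝ᵥ p) ^ 2 := by
  have h := hB.eigenvectorBasis.sum_inner_mul_inner (WithLp.toLp 2 p) (WithLp.toLp 2 p)
  simp only [real_inner_eq_dotProduct] at h
  rw [← h]
  exact Finset.sum_congr rfl fun i _ => by rw [dotProduct_comm p, sq]

theorem eigenvectorBasis_dotProduct_self {B : Matrix V V ℝ} (hB : B.IsHermitian) (i : V) :
    ⇑(hB.eigenvectorBasis i) ⬝ᵥ ⇑(hB.eigenvectorBasis i) = 1 := by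
  have h := hB.eigenvectorBasis.orthonormal.1 i
  rw [← real_inner_eq_dotProduct, real_inner_self_eq_norm_sq, h, one_pow]

/-- A real symmetric matrix attains the maximum of its Rayleigh quotient at an eigenvector. -/
theorem exists_max_rayleigh [Nonempty V] {B : Matrix V V ℝ} (hB : B.IsHermitian) :
    ∃ (μ : ℝ) (b : V → ℝ), b ≠ 0 ∧ B.mulVec b = μ • b ∧
      ∀ p : V → ℝ, p ⬝ᵥ B.mulVec p ≤ μ * (p ⬝ᵥ p) := by
  obtain ⟨i, hi⟩ := Finite.exists_max hB.eigenvalues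
  refine ⟨hB.eigenvalues i, hB.eigenvectorBasis i, ?_, hB.mulVec_eigenvectorBasis i, fun p => ?_⟩
  · intro h
    have := eigenvectorBasis_dotProduct_self hB i
    simp [h] at this
  · rw [dotProduct_mulVec_eq_sum hB, dotProduct_self_eq_sum hB, Finset.mul_sum]
    exact Finset.sum_le_sum fun j _ => mul_le_mul_of_nonneg_right (hi j) (sq_nonneg _)

theorem normAdj_eigenvalue_le_one (hreg : G.IsRegularOfDegree d) (hd : d ≠ 0) (i : V) :
    (normAdj_isHermitian G d).eigenvalues i ≤ 1 := by
  have h := dotProduct_normAdj_le hreg hd ⇑((normAdj_isHermitian G d).eigenvectorBasis i)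
  rw [Matrix.IsHermitian.mulVec_eigenvectorBasis, dotProduct_smul,
    eigenvectorBasis_dotProduct_self] at h
  simpa using h

theorem neg_one_le_normAdj_eigenvalue (hreg : G.IsRegularOfDegree d) (hd : d ≠ 0) (i : V) :
    -1 ≤ (normAdj_isHermitian G d).eigenvalues i := by
  have h := neg_le_dotProduct_normAdj hreg hd ⇑((normAdj_isHermitian G d).eigenvectorBasis i)
  rw [Matrix.IsHermitian.mulVec_eigenvectorBasis, dotProduct_smul,
    eigenvectorBasis_dotProduct_self] at h
  simpa using h

/-- The spectral gap of a connected regular graph: it is positive, at most `2`, and it bounds the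
quadratic form of `1 - A` from below on the vectors of sum zero. -/
theorem spectralGap_spec (hreg : G.IsRegularOfDegree d) (hd : d ≠ 0) (hconn : G.Connected)
    (hV : 1 < Fintype.card V) :
    0 < spectralGap G d ∧ spectralGap G d ≤ 2 ∧ ∀ p : V → ℝ, ∑ v, p v = 0 →
      p ⬝ᵥ (normAdj G d).mulVec p ≤ (1 - spectralGap G d) * (p ⬝ᵥ p) := by
  set hA := normAdj_isHermitian G d with hA_def
  set e : Fin (Fintype.card V) ≃ V := Fintype.equivOfCardEq (Fintype.card_fin _) with he
  have heig : ∀ j, hA.eigenvalues₀ j = hA.eigenvalues (e j) := fun j => by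
    simp [Matrix.IsHermitian.eigenvalues, he]
  set j0 : Fin (Fintype.card V) := ⟨0, Nat.lt_of_succ_lt hV⟩
  set j1 : Fin (Fintype.card V) := ⟨1, hV⟩
  have hgap : spectralGap G d = hA.eigenvalues (e j0) - hA.eigenvalues (e j1) := by
    rw [spectralGap, dif_pos hV, ← heig, ← heig]
  have hle0 : ∀ i, hA.eigenvalues i ≤ hA.eigenvalues (e j0) := fun i => by
    obtain ⟨j, rfl⟩ := e.surjective i
    rw [← heig, ← heig]
    exact hA.eigenvalues₀_antitone (Fin.mk_le_of_le_val (Nat.zero_le _))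
  have hle1 : ∀ i, i ≠ e j0 → hA.eigenvalues i ≤ hA.eigenvalues (e j1) := fun i hi => by
    obtain ⟨j, rfl⟩ := e.surjective i
    rw [← heig, ← heig]
    refine hA.eigenvalues₀_antitone (Fin.mk_le_of_le_val ?_)
    have : j ≠ j0 := fun h => hi (by rw [h])
    have : (j : ℕ) ≠ 0 := fun h => this (Fin.ext h)
    omega
  have hdot : ∀ p : V → ℝ, (1 : V → ℝ) ⬝ᵥ p = ∑ v, p v := fun p => by simp [dotProduct]
  have hN : (0 : ℝ) < Fintype.card V := by exact_mod_cast Nat.lt_of_succ_lt hV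
  have htop : hA.eigenvalues (e j0) = 1 := by
    refine le_antisymm (normAdj_eigenvalue_le_one hreg hd _) ?_
    have h1 := dotProduct_mulVec_eq_sum hA 1
    have h2 := dotProduct_self_eq_sum hA 1
    rw [normAdj_mulVec_one hreg hd] at h1
    have h3 : (1 : V → ℝ) ⬝ᵥ 1 ≤ hA.eigenvalues (e j0) * ((1 : V → ℝ) ⬝ᵥ 1) := by
      conv_lhs => rw [h1]
      rw [h2, Finset.mul_sum]
      exact Finset.sum_le_sum fun j _ => mul_le_mul_of_nonneg_right (hle0 j) (sq_nonneg _)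
    have h4 : (1 : V → ℝ) ⬝ᵥ 1 = Fintype.card V := by simp [dotProduct]
    rw [h4] at h3
    nlinarith
  have hconst : ∀ i, hA.eigenvalues i = 1 → ∀ u v,
      (hA.eigenvectorBasis i : EuclideanSpace ℝ V) u = hA.eigenvectorBasis i v := fun i hi =>
    eq_of_normAdj_mulVec_eq hreg hd hconn (by rw [hA.mulVec_eigenvectorBasis, hi, one_smul])
  refine ⟨?_, ?_, fun p hp => ?_⟩
  · -- A second eigenvector for the eigenvalue `1` would be constant, hence parallel to the first.
    rw [hgap, htop, sub_pos]
    refine lt_of_le_of_ne (normAdj_eigenvalue_le_one hreg hd _) fun h => ?_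
    have hne : e j0 ≠ e j1 := fun h => by
      have := congrArg Fin.val (e.injective h)
      simp [j0, j1] at this
    have horth := hA.eigenvectorBasis.orthonormal.2 hne
    obtain ⟨v⟩ := hconn.nonempty
    have hn0 := eigenvectorBasis_dotProduct_self hA (e j0)
    have hn1 := eigenvectorBasis_dotProduct_self hA (e j1)
    have h0 : ⇑(hA.eigenvectorBasis (e j0)) = fun _ => hA.eigenvectorBasis (e j0) v :=
      funext fun u => hconst _ htop u v
    have h1 : ⇑(hA.eigenvectorBasis (e j1)) = fun _ => hA.eigenvectorBasis (e j1) v :=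
      funext fun u => hconst _ h u v
    have horth' : ⇑(hA.eigenvectorBasis (e j0)) ⬝ᵥ ⇑(hA.eigenvectorBasis (e j1)) = 0 := by
      rw [← horth, real_inner_eq_dotProduct]
    rw [h0] at hn0 horth'
    rw [h1] at hn1 horth'
    simp only [dotProduct, Finset.sum_const, Finset.card_univ, nsmul_eq_mul, mul_eq_zero,
      hN.ne', false_or] at hn0 hn1 horth'
    rcases horth' with h | h
    · rw [h] at hn0; simp at hn0
    · rw [h] at hn1; simp at hn1
  · rw [hgap, htop]
    linarith [neg_one_le_normAdj_eigenvalue hreg hd (e j1)]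
  · rw [hgap, htop, sub_sub_cancel, dotProduct_mulVec_eq_sum hA, dotProduct_self_eq_sum hA,
      Finset.mul_sum]
    refine Finset.sum_le_sum fun j _ => ?_
    by_cases hj : j = e j0
    · obtain ⟨v⟩ := hconn.nonempty
      have h0 : ⇑(hA.eigenvectorBasis j) ⬝ᵥ p = 0 := by
        have h1 : ⇑(hA.eigenvectorBasis j) = fun _ => hA.eigenvectorBasis j v :=
          funext fun u => hconst _ (hj ▸ htop) u v
        rw [h1]
        simp only [dotProduct, ← Finset.mul_sum, hp, mul_zero]
      simp [h0]
    · exact mul_le_mul_of_nonneg_right (hle1 j hj) (sq_nonneg _)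

end Spectrum

/-! ### The compressed eigenvalue problem -/

section GroundState

variable {V : Type*} [Fintype V] [DecidableEq V]

/-- The generalized eigenvalue problem `B b = μ w b` with a positive diagonal weight `w`: the
largest eigenvalue is the maximum of the weighted Rayleigh quotient. -/
theorem exists_max_weighted_rayleigh [Nonempty V] {B : Matrix V V ℝ} (hB : B.IsHermitian)
    {w : V → ℝ} (hw : ∀ v, 0 < w v) :
    ∃ (μ : ℝ) (b : V → ℝ), b ≠ 0 ∧ (∀ v, B.mulVec b v = μ * (w v * b v)) ∧
      ∀ p : V → ℝ, p ⬝ᵥ B.mulVec p ≤ μ * ∑ v, w v * p v ^ 2 := by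
  set r : V → ℝ := fun v => (√(w v))⁻¹ with hr
  have hr0 : ∀ v, 0 < r v := fun v => inv_pos.2 (Real.sqrt_pos.2 (hw v))
  have hrw : ∀ v, w v * r v * r v = 1 := fun v => by
    have h1 := Real.mul_self_sqrt (hw v).le
    have h2 : √(w v) ≠ 0 := (Real.sqrt_pos.2 (hw v)).ne'
    simp only [hr]
    field_simp
    linarith
  have hC : (Matrix.diagonal r * B * Matrix.diagonal r).IsHermitian := by
    have := Matrix.isHermitian_mul_mul_conjTranspose (Matrix.diagonal r) hB
    simpa [Matrix.diagonal_conjTranspose] using this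
  have hmul : ∀ x, (Matrix.diagonal r * B * Matrix.diagonal r).mulVec x =
      fun v => r v * B.mulVec (fun u => r u * x u) v := fun x => by
    rw [← Matrix.mulVec_mulVec, ← Matrix.mulVec_mulVec]
    have : (Matrix.diagonal r).mulVec x = fun u => r u * x u := by
      ext u; rw [Matrix.mulVec_diagonal]
    ext v
    rw [Matrix.mulVec_diagonal, this]
  obtain ⟨μ, x, hx0, hx, hmax⟩ := exists_max_rayleigh hC
  refine ⟨μ, fun v => r v * x v, fun h => hx0 ?_, fun v => ?_, fun p => ?_⟩
  · ext v
    have := congrFun h v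
    simpa [(hr0 v).ne'] using this
  · rw [hmul] at hx
    have h1 := congrFun hx v
    simp only [Pi.smul_apply, smul_eq_mul] at h1
    refine mul_left_cancel₀ (hr0 v).ne' (h1.trans ?_)
    linear_combination (-(μ * x v)) * hrw v
  · have h1 := hmax fun v => w v * r v * p v
    have h2 : (fun u => r u * (w u * r u * p u)) = p := by
      ext u; linear_combination p u * hrw u
    rw [hmul, h2] at h1
    have h3 : (fun v => w v * r v * p v) ⬝ᵥ (fun v => r v * B.mulVec p v) = p ⬝ᵥ B.mulVec p :=
      Finset.sum_congr rfl fun v _ => by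
        linear_combination (p v * B.mulVec p v) * hrw v
    have h4 : (fun v => w v * r v * p v) ⬝ᵥ (fun v => w v * r v * p v) = ∑ v, w v * p v ^ 2 :=
      Finset.sum_congr rfl fun v _ => by
        linear_combination (w v * p v ^ 2) * hrw v
    rwa [h3, h4] at h1

/-- The diagonal weight `1 + k⁻¹ 1_T`. -/
noncomputable def markWeight (T : Finset V) (k : ℝ) (v : V) : ℝ := 1 + if v ∈ T then k⁻¹ else 0

theorem sum_markWeight_mul (T : Finset V) (k : ℝ) (f : V → ℝ) :
    ∑ v, markWeight T k v * f v = ∑ v, f v + k⁻¹ * ∑ v ∈ T, f v := by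
  simp [markWeight, add_mul, Finset.sum_add_distrib, ite_mul, Finset.mul_sum]

variable {G : SimpleGraph V} [DecidableRel G.Adj] {d : ℕ}

omit [DecidableEq V] in
theorem one_dotProduct_normAdj_mulVec (hreg : G.IsRegularOfDegree d) (hd : d ≠ 0) (x : V → ℝ) :
    (1 : V → ℝ) ⬝ᵥ (normAdj G d).mulVec x = (1 : V → ℝ) ⬝ᵥ x := by
  have hAs : (normAdj G d).transpose = normAdj G d := by
    ext u v; exact normAdj_comm v u
  rw [Matrix.dotProduct_mulVec, ← Matrix.mulVec_transpose, hAs, normAdj_mulVec_one hreg hd]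

omit [DecidableEq V] in
theorem sum_sq_eq_dotProduct (p : V → ℝ) : ∑ v, p v ^ 2 = p ⬝ᵥ p :=
  Finset.sum_congr rfl fun _ _ => sq _

/-- The top of the spectrum of the problem `(1 + A) b = (1 + c) (1 + k⁻¹ 1_T) b`; the constant
vector as a trial vector bounds `1 - c` from above. -/
theorem exists_ground_state (hreg : G.IsRegularOfDegree d) (hd : d ≠ 0) [Nonempty V]
    (T : Finset V) {k : ℝ} (hk : 0 < k) :
    ∃ (c : ℝ) (b : V → ℝ), b ≠ 0 ∧
      (∀ v, b v + (normAdj G d).mulVec b v = (1 + c) * (markWeight T k v * b v)) ∧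
      (∀ p : V → ℝ, p ⬝ᵥ p + p ⬝ᵥ (normAdj G d).mulVec p ≤
        (1 + c) * (p ⬝ᵥ p + k⁻¹ * ∑ v ∈ T, p v ^ 2)) ∧
      (1 - c) * (k * Fintype.card V) ≤ 2 * T.card := by
  set A := normAdj G d with hA
  have hN : (0 : ℝ) < Fintype.card V := by exact_mod_cast Fintype.card_pos
  have hB : (1 + A).IsHermitian := Matrix.isHermitian_one.add (normAdj_isHermitian G d)
  have hk' : 0 < k⁻¹ := inv_pos.2 hk
  have hw : ∀ v, 0 < markWeight T k v := fun v => by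
    unfold markWeight; split_ifs <;> linarith
  obtain ⟨μ, b, hb0, hb, hmax⟩ := exists_max_weighted_rayleigh hB hw
  have hquad : ∀ p : V → ℝ, p ⬝ᵥ (1 + A).mulVec p = p ⬝ᵥ p + p ⬝ᵥ A.mulVec p := fun p => by
    rw [Matrix.add_mulVec, Matrix.one_mulVec, dotProduct_add]
  have hmax' : ∀ p : V → ℝ, p ⬝ᵥ p + p ⬝ᵥ A.mulVec p ≤
      μ * (p ⬝ᵥ p + k⁻¹ * ∑ v ∈ T, p v ^ 2) := fun p => by
    rw [← hquad, ← sum_sq_eq_dotProduct, ← sum_markWeight_mul]; exact hmax p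
  have hb' : ∀ v, b v + A.mulVec b v = μ * (markWeight T k v * b v) := fun v => by
    rw [← hb v, Matrix.add_mulVec, Matrix.one_mulVec]; rfl
  obtain ⟨c, rfl⟩ : ∃ c, μ = 1 + c := ⟨μ - 1, by ring⟩
  refine ⟨c, b, hb0, hb', hmax', ?_⟩
  set N : ℝ := (Fintype.card V : ℝ) with hN_def
  set M : ℝ := (T.card : ℝ) with hM_def
  have hM : 0 ≤ M := Nat.cast_nonneg _
  have h1 := hmax' 1
  rw [normAdj_mulVec_one hreg hd] at h1
  have h2 : (1 : V → ℝ) ⬝ᵥ 1 = N := by simp [dotProduct, hN_def]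
  have h3 : ∑ v ∈ T, (1 : V → ℝ) v ^ 2 = M := by simp [hM_def]
  rw [h2, h3] at h1
  have h4 : 2 * N * k ≤ (1 + c) * (N * k + M) := by
    have h := mul_le_mul_of_nonneg_right h1 hk.le
    have e : (1 + c) * (N + k⁻¹ * M) * k = (1 + c) * (N * k + M) := by field_simp
    rw [e] at h; linarith
  by_cases hc : 1 + c ≤ 2
  · nlinarith
  · have : 0 < k * N := by positivity
    nlinarith

/-- The quadratic form of the eigenvalue equation, with the spectral gap for the part of `x`
orthogonal to the constants. -/
theorem gap_mul_le_of_eigenvector (hreg : G.IsRegularOfDegree d) (hd : d ≠ 0)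
    (hconn : G.Connected) (hV : 1 < Fintype.card V) {T : Finset V} {k c t : ℝ} {x : V → ℝ}
    (hx : ∀ v, x v + (normAdj G d).mulVec x v = (1 + c) * (markWeight T k v * x v))
    (hs : ∑ v, (x v - t) = 0) :
    spectralGap G d * ∑ v, (x v - t) ^ 2 + (1 + c) * (k⁻¹ * ∑ v ∈ T, x v ^ 2) ≤
      (1 - c) * ∑ v, x v ^ 2 := by
  obtain ⟨_, _, hgap⟩ := spectralGap_spec hreg hd hconn hV
  have h1 : x ⬝ᵥ x + x ⬝ᵥ (normAdj G d).mulVec x =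
      (1 + c) * (∑ v, x v ^ 2 + k⁻¹ * ∑ v ∈ T, x v ^ 2) := by
    rw [← sum_markWeight_mul, Finset.mul_sum, ← dotProduct_add]
    exact Finset.sum_congr rfl fun v _ => by
      rw [Pi.add_apply, hx v]; ring
  have h2 := hgap (fun v => x v - t) hs
  have h3 : (fun v => x v - t) = x - t • (1 : V → ℝ) := by ext v; simp
  rw [sum_sq_eq_dotProduct fun v => x v - t, sum_sq_eq_dotProduct x]
  rw [sum_sq_eq_dotProduct x] at h1
  rw [h3] at h2 ⊢
  simp only [Matrix.mulVec_sub, Matrix.mulVec_smul, normAdj_mulVec_one hreg hd,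
    sub_dotProduct, dotProduct_sub, smul_dotProduct, dotProduct_smul, smul_eq_mul,
    one_dotProduct_normAdj_mulVec hreg hd] at h2 ⊢
  rw [dotProduct_comm x 1] at h2 ⊢
  linarith

/-- An eigenvector of sum zero would have `1 - c ≥ g`; so close to the top of the spectrum the
eigenvector can be normalized by its sum. -/
theorem exists_normalized_eigenvector (hreg : G.IsRegularOfDegree d) (hd : d ≠ 0)
    (hconn : G.Connected) (hV : 1 < Fintype.card V) {T : Finset V} {k c : ℝ} {b : V → ℝ}
    (hk : 0 < k) (hc : -1 ≤ c) (hcg : 1 - c < spectralGap G d) (hb0 : b ≠ 0)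
    (hb : ∀ v, b v + (normAdj G d).mulVec b v = (1 + c) * (markWeight T k v * b v)) (t : ℝ) :
    ∃ x : V → ℝ, ∑ v, x v = t ∧
      ∀ v, x v + (normAdj G d).mulVec x v = (1 + c) * (markWeight T k v * x v) := by
  have hσ : ∑ v, b v ≠ 0 := fun h => by
    have h1 := gap_mul_le_of_eigenvector hreg hd hconn hV (t := 0) hb (by simpa using h)
    simp only [sub_zero] at h1
    have h2 : 0 ≤ (1 + c) * (k⁻¹ * ∑ v ∈ T, b v ^ 2) := by
      have : 0 ≤ 1 + c := by linarith
      positivity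
    have h3 : 0 ≤ ∑ v, b v ^ 2 := by positivity
    have h4 : ∑ v, b v ^ 2 = 0 := by nlinarith
    rw [Finset.sum_eq_zero_iff_of_nonneg fun _ _ => sq_nonneg _] at h4
    exact hb0 (funext fun v => pow_eq_zero_iff two_ne_zero |>.1 (h4 v (Finset.mem_univ v)))
  refine ⟨(t / ∑ v, b v) • b, ?_, fun v => ?_⟩
  · simp only [Pi.smul_apply, smul_eq_mul, ← Finset.mul_sum]
    field_simp
  · simp only [Matrix.mulVec_smul, Pi.smul_apply, smul_eq_mul]
    linear_combination (t / ∑ v, b v) * hb v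

/-- The eigenvector of the top of the spectrum, with sum `√N`, is close to the uniform unit
vector; the distance `1 - c` is at least of the order of `g M / N`, and the weight of the
eigenvector on `T` is bounded below in terms of it. -/
theorem ground_state_estimates (hreg : G.IsRegularOfDegree d) (hd : d ≠ 0) (hconn : G.Connected)
    (hV : 1 < Fintype.card V) {T : Finset V} {k c : ℝ} {b : V → ℝ} (hk : 0 < k) (hc0 : 0 ≤ c)
    (hcg : 1 - c ≤ spectralGap G d / 2) (hbs : ∑ v, b v = √(Fintype.card V))
    (hb : ∀ v, b v + (normAdj G d).mulVec b v = (1 + c) * (markWeight T k v * b v)) :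
    spectralGap G d * T.card ≤
        2 * (k * spectralGap G d + 2) * Fintype.card V * (1 - c) ∧
      (∑ v, (b v - 1 / √(Fintype.card V)) ^ 2 + k⁻¹ * ∑ v ∈ T, b v ^ 2) * spectralGap G d ≤
        4 * (1 - c) ∧
      (k * (1 - c)) ^ 2 * Fintype.card V ≤ (1 + c) ^ 2 * (T.card * ∑ v ∈ T, b v ^ 2) := by
  obtain ⟨hg0, hg2, -⟩ := spectralGap_spec hreg hd hconn hV
  have hN : (0 : ℝ) < Fintype.card V := by exact_mod_cast Nat.lt_of_succ_lt hV
  have hmain := fun t => gap_mul_le_of_eigenvector hreg hd hconn hV (t := t) hb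
  set g := spectralGap G d
  set N : ℝ := (Fintype.card V : ℝ) with hN_def
  set M : ℝ := (T.card : ℝ) with hM_def
  have hk' : 0 < k⁻¹ := inv_pos.2 hk
  have hsN : 0 < √N := Real.sqrt_pos.2 hN
  have hsN2 : √N * √N = N := Real.mul_self_sqrt hN.le
  have hinvN : 1 / N = 1 / √N * (1 / √N) := by rw [one_div_mul_one_div, hsN2]
  have hb1 : ∑ v, (b v - 1 / √N) = 0 := by
    rw [Finset.sum_sub_distrib, hbs, Finset.sum_const, Finset.card_univ, nsmul_eq_mul, ← hN_def]
    field_simp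
    linarith
  have hb2 : ∑ v, b v ^ 2 = 1 + ∑ v, (b v - 1 / √N) ^ 2 := by
    have h1 : ∀ v, b v ^ 2 = (b v - 1 / √N) ^ 2 + (2 * (1 / √N) * (b v - 1 / √N) + 1 / N) :=
      fun v => by rw [hinvN]; ring
    simp only [h1, Finset.sum_add_distrib, ← Finset.mul_sum, hb1, Finset.sum_const,
      Finset.card_univ, nsmul_eq_mul, ← hN_def, mul_zero, zero_add, mul_one_div_cancel hN.ne']
    exact add_comm _ _
  replace hmain := hmain _ hb1
  rw [hb2] at hmain
  have hE0 : 0 ≤ ∑ v, (b v - 1 / √N) ^ 2 := by positivity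
  have hB0 : 0 ≤ ∑ v ∈ T, b v ^ 2 := by positivity
  -- The marked vertices carry weight `M / N` in the uniform vector.
  have hMN : M / N ≤ 2 * ∑ v ∈ T, b v ^ 2 + 2 * ∑ v, (b v - 1 / √N) ^ 2 := by
    have h1 : ∑ v ∈ T, (b v - 1 / √N) ^ 2 ≤ ∑ v, (b v - 1 / √N) ^ 2 :=
      Finset.sum_le_sum_of_subset_of_nonneg (Finset.subset_univ T) fun _ _ _ => sq_nonneg _
    have h2 : ∑ v ∈ T, 1 / N ≤ ∑ v ∈ T, (2 * b v ^ 2 + 2 * (b v - 1 / √N) ^ 2) :=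
      Finset.sum_le_sum fun v _ => by
        rw [hinvN]
        nlinarith [sq_nonneg (2 * b v - 1 / √N)]
    rw [Finset.sum_const, nsmul_eq_mul, Finset.sum_add_distrib, ← Finset.mul_sum,
      ← Finset.mul_sum, mul_one_div, ← hM_def] at h2
    linarith
  set E := ∑ v, (b v - 1 / √N) ^ 2
  set S := ∑ v ∈ T, b v ^ 2 with hS
  have hc1 : 0 ≤ 1 - c := by
    by_contra h
    push Not at h
    have h1 : 0 ≤ g * E := by positivity
    have h2 : 0 ≤ (1 + c) * (k⁻¹ * S) := by positivity
    nlinarith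
  have hmain' : g / 2 * E + k⁻¹ * S ≤ 1 - c := by
    have h2 : 0 ≤ c * (k⁻¹ * S) := by positivity
    nlinarith
  have hE : g * E ≤ 2 * (1 - c) := by
    have : 0 ≤ k⁻¹ * S := by positivity
    linarith
  have hSk : k⁻¹ * S ≤ 1 - c := by
    have : 0 ≤ g / 2 * E := by positivity
    linarith
  have hS' : S ≤ k * (1 - c) := by
    rwa [inv_mul_le_iff₀ hk] at hSk
  have hlow : g * M ≤ 2 * (k * g + 2) * N * (1 - c) := by
    have h1 : M ≤ (2 * S + 2 * E) * N := by rwa [div_le_iff₀ hN] at hMN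
    have h2 : g * M ≤ (2 * (g * S) + 2 * (g * E)) * N := by nlinarith
    have h3 : (2 * (g * S) + 2 * (g * E)) * N ≤
        (2 * (g * (k * (1 - c))) + 2 * (2 * (1 - c))) * N := by gcongr
    linarith
  refine ⟨hlow, by nlinarith, ?_⟩
  -- The sum of the eigenvalue equation over all vertices.
  have hsum : k * (1 - c) * √N = (1 + c) * ∑ v ∈ T, b v := by
    have h1 : ∑ v, (b v + (normAdj G d).mulVec b v) =
        ∑ v, (1 + c) * (markWeight T k v * b v) := Finset.sum_congr rfl fun v _ => hb v
    have h2 : ∑ v, (normAdj G d).mulVec b v = ∑ v, b v := by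
      simpa [dotProduct] using one_dotProduct_normAdj_mulVec hreg hd b
    rw [Finset.sum_add_distrib, h2, ← Finset.mul_sum, sum_markWeight_mul, hbs] at h1
    field_simp at h1
    linarith
  have h1 : (∑ v ∈ T, b v) ^ 2 ≤ M * S := sq_sum_le_card_mul_sum_sq
  calc (k * (1 - c)) ^ 2 * N = (k * (1 - c) * √N) ^ 2 := by rw [mul_pow _ (√N), sq (√N), hsN2]
    _ = (1 + c) ^ 2 * (∑ v ∈ T, b v) ^ 2 := by rw [hsum, mul_pow]
    _ ≤ _ := by gcongr

end GroundState

/-! ### Products of two Hermitian involutions -/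

section Involutions

variable {n : Type*} [Fintype n] [DecidableEq n]

omit [DecidableEq n] in
theorem norm_toLp_sq (y : n → ℂ) : ‖WithLp.toLp 2 y‖ ^ 2 = ∑ x, ‖y x‖ ^ 2 :=
  EuclideanSpace.norm_sq_eq _

omit [DecidableEq n] in
theorem star_dotProduct_self (y : n → ℂ) :
    star y ⬝ᵥ y = ((‖WithLp.toLp 2 y‖ ^ 2 : ℝ) : ℂ) := by
  rw [norm_toLp_sq, Complex.ofReal_sum]
  exact Finset.sum_congr rfl fun x _ => by
    rw [Pi.star_apply, Complex.star_def, Complex.conj_mul', Complex.ofReal_pow]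

omit [DecidableEq n] in
theorem star_mulVec_dotProduct {H : Matrix n n ℂ} (hH : H.IsHermitian) (x y : n → ℂ) :
    star (H.mulVec x) ⬝ᵥ y = star x ⬝ᵥ H.mulVec y := by
  rw [Matrix.star_mulVec, hH.eq, Matrix.dotProduct_mulVec]

theorem norm_mulVec_of_involution {H : Matrix n n ℂ} (hH : H.IsHermitian) (h2 : H * H = 1)
    (y : n → ℂ) : ‖WithLp.toLp 2 (H.mulVec y)‖ = ‖WithLp.toLp 2 y‖ := by
  have h := star_dotProduct_self (H.mulVec y)
  rw [star_mulVec_dotProduct hH, Matrix.mulVec_mulVec, h2, Matrix.one_mulVec,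
    star_dotProduct_self, Complex.ofReal_inj] at h
  exact ((sq_eq_sq₀ (norm_nonneg _) (norm_nonneg _)).1 h).symm

variable {S R : Matrix n n ℂ}

/-- A product of two Hermitian involutions is an isometry. -/
theorem norm_pow_mulVec (hS : S.IsHermitian) (hS2 : S * S = 1) (hR : R.IsHermitian)
    (hR2 : R * R = 1) (m : ℕ) (y : n → ℂ) :
    ‖WithLp.toLp 2 (((S * R) ^ m).mulVec y)‖ = ‖WithLp.toLp 2 y‖ := by
  induction m generalizing y with
  | zero => simp
  | succ m ih =>
    rw [pow_succ, ← Matrix.mulVec_mulVec, ih, ← Matrix.mulVec_mulVec,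
      norm_mulVec_of_involution hS hS2, norm_mulVec_of_involution hR hR2]

/-- Eigenvectors of a product `S R` of two Hermitian involutions: unless the eigenvalue is `±1`,
the component of the eigenvector in the range of `R + 1` is non-zero, and there the compression
of `S` has the real part of the eigenvalue as an eigenvalue. -/
theorem exists_fixed_of_eigenvector (hS2 : S * S = 1) (hR : R.IsHermitian)
    (hR2 : R * R = 1) {θ : ℝ} (hθ : Real.sin θ ≠ 0) {x : n → ℂ} (hx : x ≠ 0)
    (h : (S * R).mulVec x = Complex.exp (θ * Complex.I) • x) :
    ∃ y : n → ℂ, y ≠ 0 ∧ R.mulVec y = y ∧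
      star y ⬝ᵥ S.mulVec y = (Real.cos θ : ℂ) * (star y ⬝ᵥ y) := by
  set ξ := Complex.exp (θ * Complex.I) with hξ
  set ζ := Complex.exp (-(θ * Complex.I)) with hζ
  have hξζ : ζ * ξ = 1 := by rw [hξ, hζ, ← Complex.exp_add]; simp
  have hcos : ξ + ζ = 2 * (Real.cos θ : ℂ) := by
    rw [Complex.ofReal_cos, Complex.cos, hξ, hζ, neg_mul]; ring
  have hSS : ∀ v, S.mulVec (S.mulVec v) = v := fun v => by
    rw [Matrix.mulVec_mulVec, hS2, Matrix.one_mulVec]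
  have hRR : ∀ v, R.mulVec (R.mulVec v) = v := fun v => by
    rw [Matrix.mulVec_mulVec, hR2, Matrix.one_mulVec]
  rw [← Matrix.mulVec_mulVec] at h
  have h1 : R.mulVec x = ξ • S.mulVec x := by
    rw [← Matrix.mulVec_smul, ← h, hSS]
  have h2 : S.mulVec x = ζ • R.mulVec x := by rw [h1, smul_smul, hξζ, one_smul]
  have h3 : R.mulVec (S.mulVec x) = ζ • x := by rw [h2, Matrix.mulVec_smul, hRR]
  refine ⟨x + R.mulVec x, fun h0 => ?_, ?_, ?_⟩
  · have h4 : R.mulVec x = -x := (neg_eq_of_add_eq_zero_right h0).symm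
    have h5 : S.mulVec x = -(ξ • x) := by
      rw [← h, h4, Matrix.mulVec_neg, neg_neg]
    have h6 : (ξ - ζ) • x = 0 := by
      rw [sub_smul, sub_eq_zero, ← neg_inj, ← h5, h2, h4, smul_neg]
    rcases smul_eq_zero.1 h6 with h7 | h7
    · refine hθ ?_
      have h8 : (Real.sin θ : ℂ) = 0 := by
        rw [Complex.ofReal_sin, Complex.sin, neg_mul, ← hξ, ← hζ, ← neg_sub ξ ζ, h7]; simp
      exact_mod_cast h8
    · exact hx h7
  · rw [Matrix.mulVec_add, hRR, add_comm]
  · set y := x + R.mulVec x with hy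
    have hRy : R.mulVec y = y := by rw [hy, Matrix.mulVec_add, hRR, add_comm]
    have h4 : S.mulVec y + R.mulVec (S.mulVec y) = (ξ + ζ) • y := by
      rw [hy, Matrix.mulVec_add, Matrix.mulVec_add, h, h3, Matrix.mulVec_smul, h2]
      module
    have h5 : star y ⬝ᵥ R.mulVec (S.mulVec y) = star y ⬝ᵥ S.mulVec y := by
      rw [← star_mulVec_dotProduct hR, hRy]
    have h6 := congrArg (fun w => star y ⬝ᵥ w) h4
    simp only [dotProduct_add, h5, dotProduct_smul, hcos, smul_eq_mul] at h6
    linear_combination h6 / 2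

/-- On a fixed vector `z` of `R` for which `S z + R S z = 2 cos θ z`, the powers of `S R` act as
Chebyshev polynomials of the second kind. -/
theorem sin_smul_pow_mulVec (hS2 : S * S = 1) {θ : ℝ} {z : n → ℂ} (hz : R.mulVec z = z)
    (hSz : S.mulVec z + R.mulVec (S.mulVec z) = (2 * (Real.cos θ : ℂ)) • z) (m : ℕ) :
    (Real.sin θ : ℂ) • ((S * R) ^ m).mulVec z =
      (Real.sin (m * θ) : ℂ) • S.mulVec z - (Real.sin (m * θ - θ) : ℂ) • z := by
  have hU1 : (S * R).mulVec z = S.mulVec z := by rw [← Matrix.mulVec_mulVec, hz]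
  have hU2 : (S * R).mulVec (S.mulVec z) = (2 * (Real.cos θ : ℂ)) • S.mulVec z - z := by
    rw [← Matrix.mulVec_mulVec, eq_sub_of_add_eq' hSz, Matrix.mulVec_sub, Matrix.mulVec_smul,
      Matrix.mulVec_mulVec, hS2, Matrix.one_mulVec]
  induction m with
  | zero => simp
  | succ m ih =>
    have hs : Real.sin ((m : ℝ) * θ + θ) =
        2 * Real.cos θ * Real.sin (m * θ) - Real.sin (m * θ - θ) := by
      rw [Real.sin_add, Real.sin_sub]; ring
    have e1 : ((m + 1 : ℕ) : ℝ) * θ = m * θ + θ := by push_cast; ring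
    rw [pow_succ', ← Matrix.mulVec_mulVec, ← Matrix.mulVec_smul, ih, Matrix.mulVec_sub,
      Matrix.mulVec_smul, Matrix.mulVec_smul, hU1, hU2, e1, add_sub_cancel_right, hs]
    push_cast
    module

theorem hasEigenvalue_of_fixed (hS2 : S * S = 1) {θ : ℝ} (hθ : Real.sin θ ≠ 0) {z : n → ℂ}
    (hz0 : z ≠ 0) (hz : R.mulVec z = z)
    (hSz : S.mulVec z + R.mulVec (S.mulVec z) = (2 * (Real.cos θ : ℂ)) • z) :
    Module.End.HasEigenvalue (Matrix.toLin' (S * R)) (Complex.exp (θ * Complex.I)) := by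
  set ξ := Complex.exp (θ * Complex.I) with hξ
  set ζ := Complex.exp (-(θ * Complex.I)) with hζ
  have hξζ : ξ * ζ = 1 := by rw [hξ, hζ, ← Complex.exp_add]; simp
  have hcos : 2 * (Real.cos θ : ℂ) = ξ + ζ := by
    rw [Complex.ofReal_cos, Complex.cos, hξ, hζ, neg_mul]; ring
  have hU1 : (S * R).mulVec z = S.mulVec z := by rw [← Matrix.mulVec_mulVec, hz]
  have hU2 : (S * R).mulVec (S.mulVec z) = (ξ + ζ) • S.mulVec z - z := by
    rw [← Matrix.mulVec_mulVec, eq_sub_of_add_eq' hSz, Matrix.mulVec_sub, Matrix.mulVec_smul,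
      Matrix.mulVec_mulVec, hS2, Matrix.one_mulVec, hcos]
  refine Module.End.hasEigenvalue_of_hasEigenvector (x := S.mulVec z - ζ • z) ⟨?_, fun h => ?_⟩
  · rw [Module.End.mem_eigenspace_iff, Matrix.toLin'_apply, Matrix.mulVec_sub, Matrix.mulVec_smul,
      hU1, hU2, smul_sub, smul_smul, hξζ]
    module
  · -- `S z = ζ z` would give `ζ ^ 2 = 1` for the involution `S`.
    have h1 : S.mulVec z = ζ • z := sub_eq_zero.1 h
    have h2 : z = (ζ * ζ) • z := by
      conv_lhs => rw [← Matrix.one_mulVec z, ← hS2, ← Matrix.mulVec_mulVec, h1,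
        Matrix.mulVec_smul, h1, smul_smul]
    have h3 : (ξ - ζ) • z = 0 := by
      have h4 : ξ • z = (ξ * (ζ * ζ)) • z := by rw [← smul_smul, ← h2]
      rw [sub_smul, h4, ← mul_assoc, hξζ, one_mul, sub_self]
    rcases smul_eq_zero.1 h3 with h7 | h7
    · refine hθ ?_
      have h8 : (Real.sin θ : ℂ) = 0 := by
        rw [Complex.ofReal_sin, Complex.sin, neg_mul, ← hξ, ← hζ, ← neg_sub ξ ζ, h7]; simp
      exact_mod_cast h8
    · exact hz0 h7

end Involutions

/-! ### The walk and the oracle as involutions -/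

section Operators

variable {V : Type*} [Fintype V] [DecidableEq V] {G : SimpleGraph V} {d : ℕ}

/-- The map `f ↦ ∑_{a,v} f (a, v) |a⟩|ψ_v⟩`, an isometry for `d ≠ 0`. -/
noncomputable def embed (d : ℕ) (f : Fin 2 × V → ℂ) : Fin 2 × Fin d × V → ℂ :=
  fun x => coinState d x.2.1 * f (x.1, x.2.2)

/-- The amplitudes `⟨a, ψ_v | y⟩`: the adjoint of `embed`. -/
noncomputable def amplitude (y : Fin 2 × Fin d × V → ℂ) : Fin 2 × V → ℂ :=
  fun a => ∑ h, coinState d h * y (a.1, h, a.2)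

/-- The projection `|δ⟩⟨δ| ⊗ ∑_{v ∈ T} |v⟩⟨v|`. -/
noncomputable def markProj (T : Finset V) (δ : ℝ) (f : Fin 2 × V → ℂ) : Fin 2 × V → ℂ :=
  fun a => if a.2 ∈ T then ancilla δ a.1 * ∑ b, ancilla δ b * f (b, a.2) else 0

theorem star_coinState (d : ℕ) : star (coinState d) = coinState d := by
  ext h; simp [coinState]

theorem star_ancilla (δ : ℝ) : star (ancilla δ) = ancilla δ := by
  ext a
  fin_cases a <;> simp [ancilla, Complex.conj_ofReal, -Complex.ofReal_cos, -Complex.ofReal_sin]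

theorem coinState_mul_self (h h' : Fin d) : coinState d h * coinState d h' = 1 / (d : ℂ) := by
  simp only [coinState]
  rw [← Complex.ofReal_mul, one_div_mul_one_div, Real.mul_self_sqrt (Nat.cast_nonneg d)]
  simp

theorem sum_coinState_mul_self (hd : d ≠ 0) : ∑ h, coinState d h * coinState d h = 1 := by
  simp only [coinState_mul_self, Finset.sum_const, Finset.card_univ, Fintype.card_fin,
    nsmul_eq_mul]
  field_simp

theorem ancilla_mul_self (δ : ℝ) : ∑ b, ancilla δ b * ancilla δ b = 1 := by
  have := Real.cos_sq_add_sin_sq δ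
  rw [Fin.sum_univ_two]
  simp only [ancilla, Matrix.cons_val_zero, Matrix.cons_val_one]
  rw [← Complex.ofReal_mul, ← Complex.ofReal_mul, ← Complex.ofReal_add, ← sq, ← sq, this]
  simp

omit [Fintype V] [DecidableEq V] in
theorem amplitude_embed (hd : d ≠ 0) (f : Fin 2 × V → ℂ) : amplitude (embed d f) = f := by
  ext a
  simp only [amplitude, embed, ← mul_assoc, ← Finset.sum_mul, sum_coinState_mul_self hd, one_mul]

omit [Fintype V] in
theorem markProj_markProj (T : Finset V) (δ : ℝ) (f : Fin 2 × V → ℂ) :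
    markProj T δ (markProj T δ f) = markProj T δ f := by
  ext a
  by_cases h : a.2 ∈ T
  · have hs : ∀ s : ℂ, ∑ b, ancilla δ b * (ancilla δ b * s) = s := fun s => by
      simp only [← mul_assoc, ← Finset.sum_mul, ancilla_mul_self, one_mul]
    simp only [markProj, h, if_true, hs]
  · simp [markProj, h]

omit [DecidableEq V] in
theorem star_embed_dotProduct (f : Fin 2 × V → ℂ) (y : Fin 2 × Fin d × V → ℂ) :
    star (embed d f) ⬝ᵥ y = star f ⬝ᵥ amplitude y := by
  simp only [dotProduct, amplitude, Fintype.sum_prod_type, Pi.star_apply, embed, star_mul',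
    Finset.mul_sum]
  refine Finset.sum_congr rfl fun a _ => ?_
  rw [Finset.sum_comm]
  refine Finset.sum_congr rfl fun v _ => Finset.sum_congr rfl fun h _ => ?_
  rw [← Pi.star_apply (coinState d), star_coinState]
  ring

omit [DecidableEq V] in
theorem norm_embed_sq (hd : d ≠ 0) (f : Fin 2 × V → ℂ) :
    ‖WithLp.toLp 2 (embed d f)‖ ^ 2 = ∑ a, ‖f a‖ ^ 2 := by
  have h := star_dotProduct_self (embed d f)
  rw [star_embed_dotProduct, amplitude_embed hd, star_dotProduct_self, Complex.ofReal_inj] at h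
  rw [← h, norm_toLp_sq]

theorem controlled_mulVec_zero {n : Type*} [Fintype n] (A B : Matrix n n ℂ) (y : Fin 2 × n → ℂ)
    (x : n) : (controlled A B).mulVec y (0, x) = A.mulVec (fun x => y (0, x)) x := by
  simp [controlled, Matrix.mulVec, dotProduct, Fintype.sum_prod_type, Matrix.kroneckerMap_apply]

theorem controlled_mulVec_one {n : Type*} [Fintype n] (A B : Matrix n n ℂ) (y : Fin 2 × n → ℂ)
    (x : n) : (controlled A B).mulVec y (1, x) = B.mulVec (fun x => y (1, x)) x := by
  simp [controlled, Matrix.mulVec, dotProduct, Fintype.sum_prod_type, Matrix.kroneckerMap_apply]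

theorem controlled_mul_controlled {n : Type*} [Fintype n] [DecidableEq n]
    (A B A' B' : Matrix n n ℂ) :
    controlled A B * controlled A' B' = controlled (A * A') (B * B') := by
  refine Matrix.mulVec_injective (funext fun y => funext fun x => ?_)
  obtain ⟨a, x⟩ := x
  rw [← Matrix.mulVec_mulVec]
  fin_cases a
  · simp only [Fin.zero_eta, controlled_mulVec_zero, ← Matrix.mulVec_mulVec]
  · simp only [Fin.mk_one, controlled_mulVec_one, ← Matrix.mulVec_mulVec]

theorem controlled_isHermitian {n : Type*} {A B : Matrix n n ℂ} (hA : A.IsHermitian)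
    (hB : B.IsHermitian) : (controlled A B).IsHermitian := by
  refine Matrix.IsHermitian.ext fun x y => ?_
  obtain ⟨a, x⟩ := x
  obtain ⟨b, y⟩ := y
  fin_cases a <;> fin_cases b <;>
    simp [controlled, Matrix.kroneckerMap_apply, hA.apply, hB.apply]

theorem coinOp_mulVec (w : Fin d × V → ℂ) (x : Fin d × V) :
    (coinOp V d).mulVec w x =
      2 * (coinState d x.1 * ∑ h, coinState d h * w (h, x.2)) - w x := by
  obtain ⟨g, v⟩ := x
  rw [coinOp, Matrix.sub_mulVec, Matrix.one_mulVec, Matrix.smul_mulVec, Pi.sub_apply,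
    Pi.smul_apply, smul_eq_mul, star_coinState]
  congr 2
  simp [Matrix.mulVec, dotProduct, Fintype.sum_prod_type, Matrix.kroneckerMap_apply,
    Matrix.vecMulVec_apply, Matrix.one_apply, Finset.mul_sum, mul_assoc]

omit [Fintype V] in
theorem coinOp_isHermitian : (coinOp V d).IsHermitian := by
  rw [Matrix.IsHermitian, coinOp, Matrix.conjTranspose_sub, Matrix.conjTranspose_smul,
    Matrix.conjTranspose_kronecker, Matrix.conjTranspose_vecMulVec, star_star]
  simp

theorem coinOp_mul_self (hd : d ≠ 0) : coinOp V d * coinOp V d = 1 := by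
  refine Matrix.mulVec_injective (funext fun w => funext fun x => ?_)
  rw [← Matrix.mulVec_mulVec, Matrix.one_mulVec]
  simp only [coinOp_mulVec, mul_sub, Finset.sum_sub_distrib]
  have h : ∀ s : ℂ, ∑ h, coinState d h * (2 * (coinState d h * s)) = 2 * s := fun s => by
    calc _ = ∑ h, coinState d h * coinState d h * (2 * s) :=
          Finset.sum_congr rfl fun h _ => by ring
      _ = _ := by rw [← Finset.sum_mul, sum_coinState_mul_self hd, one_mul]
  rw [h]
  ring

omit [Fintype V] [DecidableEq V] in
theorem flipFlop_flipFlop (ν : PortLabelling G d) (x : Fin d × V) :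
    flipFlop ν (flipFlop ν x) = x := by
  obtain ⟨h, u⟩ := x
  have key : ∀ (a b : V) (p : a ∈ G.neighborSet b), b = u → a = ν u h →
      (((ν b).symm ⟨a, p⟩, b) : Fin d × V) = (h, u) := by
    rintro a b p rfl rfl
    simp
  exact key _ _ _ (congrArg Subtype.val ((ν _).apply_symm_apply _)) rfl

theorem shiftOp_mulVec (ν : PortLabelling G d) (w : Fin d × V → ℂ) (x : Fin d × V) :
    (shiftOp ν).mulVec w x = w (flipFlop ν x) := by
  have h : ∀ y, (x = flipFlop ν y) ↔ (y = flipFlop ν x) := fun y =>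
    ⟨fun h => by rw [h, flipFlop_flipFlop], fun h => by rw [h, flipFlop_flipFlop]⟩
  simp [shiftOp, Matrix.mulVec, dotProduct, h]

omit [Fintype V] in
theorem shiftOp_isHermitian (ν : PortLabelling G d) : (shiftOp ν).IsHermitian := by
  refine Matrix.IsHermitian.ext fun x y => ?_
  have h : (x = flipFlop ν y) ↔ (y = flipFlop ν x) :=
    ⟨fun h => by rw [h, flipFlop_flipFlop], fun h => by rw [h, flipFlop_flipFlop]⟩
  simp [shiftOp, h, apply_ite]

theorem shiftOp_mul_self (ν : PortLabelling G d) : shiftOp ν * shiftOp ν = 1 := by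
  refine Matrix.mulVec_injective (funext fun w => funext fun x => ?_)
  rw [← Matrix.mulVec_mulVec, Matrix.one_mulVec, shiftOp_mulVec, shiftOp_mulVec,
    flipFlop_flipFlop]

theorem targetProj_mulVec (T : Finset V) (δ : ℝ) (y : Fin 2 × Fin d × V → ℂ) :
    (targetProj d T δ).mulVec y = embed d (markProj T δ (amplitude y)) := by
  have hdot : ∀ i, star (targetState d δ i) ⬝ᵥ y = ∑ b, ancilla δ b * amplitude y (b, i) := by
    intro i
    have h1 : targetState d δ i =
        embed d fun a => ancilla δ a.1 * (Pi.single i (1 : ℂ) : V → ℂ) a.2 := by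
      ext x; simp only [targetState, vertexState, embed]; ring
    have h2 : ∀ a, star (ancilla δ a) = ancilla δ a := fun a => congrFun (star_ancilla δ) a
    rw [h1, star_embed_dotProduct]
    simp only [dotProduct, Fintype.sum_prod_type, Pi.star_apply, star_mul', h2]
    refine Finset.sum_congr rfl fun b _ => ?_
    rw [Finset.sum_eq_single i]
    · simp
    · intro v _ hv; simp [Pi.single_eq_of_ne hv]
    · simp
  ext ⟨a, h, v⟩
  rw [targetProj, Matrix.sum_mulVec, Finset.sum_apply]
  simp only [Matrix.vecMulVec_mulVec, hdot, Pi.smul_apply, targetState, vertexState, embed,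
    markProj, MulOpposite.smul_eq_mul_unop, MulOpposite.unop_op]
  by_cases hv : v ∈ T
  · rw [Finset.sum_eq_single_of_mem v hv]
    · simp only [hv, if_true, Pi.single_eq_same]; ring
    · intro i _ hi; simp [Pi.single_eq_of_ne hi.symm]
  · rw [if_neg hv, mul_zero]
    refine Finset.sum_eq_zero fun i hi => ?_
    have : v ≠ i := fun h => hv (h ▸ hi)
    simp [Pi.single_eq_of_ne this]

omit [Fintype V] in
theorem targetProj_isHermitian (T : Finset V) (δ : ℝ) : (targetProj d T δ).IsHermitian := by
  rw [Matrix.IsHermitian, targetProj, Matrix.conjTranspose_sum]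
  exact Finset.sum_congr rfl fun i _ => by
    rw [Matrix.conjTranspose_vecMulVec, star_star]

theorem targetProj_mul_self (hd : d ≠ 0) (T : Finset V) (δ : ℝ) :
    targetProj d T δ * targetProj d T δ = targetProj d T δ := by
  refine Matrix.mulVec_injective (funext fun y => ?_)
  rw [← Matrix.mulVec_mulVec, targetProj_mulVec, targetProj_mulVec, amplitude_embed hd,
    markProj_markProj]

/-- The flip `S ⊗ |0⟩⟨0| - C ⊗ |1⟩⟨1|`. -/
noncomputable def flipOp (ν : PortLabelling G d) :
    Matrix (Fin 2 × Fin d × V) (Fin 2 × Fin d × V) ℂ :=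
  controlled (shiftOp ν) (-coinOp V d)

/-- The reflection about the part of the span of the states `|a⟩|ψ_v⟩` orthogonal to the target
subspace. -/
noncomputable def coinReflection (d : ℕ) (T : Finset V) (δ : ℝ) :
    Matrix (Fin 2 × Fin d × V) (Fin 2 × Fin d × V) ℂ :=
  controlled (coinOp V d) (coinOp V d) * (1 - (2 : ℂ) • targetProj d T δ)

theorem searchOp_eq (hd : d ≠ 0) (ν : PortLabelling G d) (T : Finset V) (δ : ℝ) :
    searchOp ν T δ = flipOp ν * coinReflection d T δ := by
  rw [searchOp, flipOp, coinReflection, ← mul_assoc, controlled_mul_controlled, walkOp,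
    neg_mul, coinOp_mul_self hd]

omit [Fintype V] in
theorem flipOp_isHermitian (ν : PortLabelling G d) : (flipOp ν).IsHermitian :=
  controlled_isHermitian (shiftOp_isHermitian ν) coinOp_isHermitian.neg

theorem controlled_one_one {n : Type*} [Fintype n] [DecidableEq n] :
    controlled (1 : Matrix n n ℂ) 1 = 1 := by
  refine Matrix.mulVec_injective (funext fun y => funext fun x => ?_)
  obtain ⟨a, x⟩ := x
  fin_cases a
  · simp only [Fin.zero_eta, controlled_mulVec_zero, Matrix.one_mulVec]
  · simp only [Fin.mk_one, controlled_mulVec_one, Matrix.one_mulVec]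

theorem flipOp_mul_self (hd : d ≠ 0) (ν : PortLabelling G d) : flipOp ν * flipOp ν = 1 := by
  rw [flipOp, controlled_mul_controlled, shiftOp_mul_self, neg_mul_neg, coinOp_mul_self hd,
    controlled_one_one]

theorem controlled_coinOp_mulVec (y : Fin 2 × Fin d × V → ℂ) :
    (controlled (coinOp V d) (coinOp V d)).mulVec y = (2 : ℂ) • embed d (amplitude y) - y := by
  ext ⟨a, x⟩
  fin_cases a
  · simp only [Fin.zero_eta, controlled_mulVec_zero, coinOp_mulVec]
    simp [embed, amplitude]
  · simp only [Fin.mk_one, controlled_mulVec_one, coinOp_mulVec]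
    simp [embed, amplitude]

theorem controlled_coinOp_mul_targetProj (hd : d ≠ 0) (T : Finset V) (δ : ℝ) :
    controlled (coinOp V d) (coinOp V d) * targetProj d T δ = targetProj d T δ := by
  refine Matrix.mulVec_injective (funext fun y => ?_)
  rw [← Matrix.mulVec_mulVec, controlled_coinOp_mulVec, targetProj_mulVec, amplitude_embed hd]
  module

theorem targetProj_mul_controlled_coinOp (hd : d ≠ 0) (T : Finset V) (δ : ℝ) :
    targetProj d T δ * controlled (coinOp V d) (coinOp V d) = targetProj d T δ := by
  have h := congrArg Matrix.conjTranspose (controlled_coinOp_mul_targetProj hd T δ)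
  rwa [Matrix.conjTranspose_mul, (targetProj_isHermitian T δ).eq,
    (controlled_isHermitian coinOp_isHermitian coinOp_isHermitian).eq] at h

theorem coinReflection_eq (hd : d ≠ 0) (T : Finset V) (δ : ℝ) :
    coinReflection d T δ =
      controlled (coinOp V d) (coinOp V d) - (2 : ℂ) • targetProj d T δ := by
  rw [coinReflection, mul_sub, mul_one, mul_smul_comm, controlled_coinOp_mul_targetProj hd]

theorem coinReflection_isHermitian (hd : d ≠ 0) (T : Finset V) (δ : ℝ) :
    (coinReflection d T δ).IsHermitian := by
  rw [coinReflection_eq hd, Matrix.IsHermitian, Matrix.conjTranspose_sub,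
    Matrix.conjTranspose_smul, (targetProj_isHermitian T δ).eq,
    (controlled_isHermitian coinOp_isHermitian coinOp_isHermitian).eq]
  simp

theorem coinReflection_mul_self (hd : d ≠ 0) (T : Finset V) (δ : ℝ) :
    coinReflection d T δ * coinReflection d T δ = 1 := by
  rw [coinReflection_eq hd, sub_mul, mul_sub, mul_sub, controlled_mul_controlled,
    coinOp_mul_self hd, controlled_one_one]
  simp only [smul_mul_assoc, mul_smul_comm, controlled_coinOp_mul_targetProj hd,
    targetProj_mul_controlled_coinOp hd, targetProj_mul_self hd]
  module

theorem coinReflection_mulVec (hd : d ≠ 0) (T : Finset V) (δ : ℝ)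
    (y : Fin 2 × Fin d × V → ℂ) :
    (coinReflection d T δ).mulVec y =
      (2 : ℂ) • embed d (amplitude y - markProj T δ (amplitude y)) - y := by
  rw [coinReflection_eq hd, Matrix.sub_mulVec, Matrix.smul_mulVec, controlled_coinOp_mulVec,
    targetProj_mulVec]
  ext x
  simp only [Pi.sub_apply, Pi.smul_apply, smul_eq_mul, embed]
  ring

theorem amplitude_flipOp_zero [DecidableRel G.Adj] (ν : PortLabelling G d) (f : Fin 2 × V → ℂ)
    (v : V) : amplitude ((flipOp ν).mulVec (embed d f)) (0, v) =
      ∑ u, (normAdj G d v u : ℂ) * f (0, u) := by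
  have h1 : amplitude ((flipOp ν).mulVec (embed d f)) (0, v) =
      ∑ h, 1 / (d : ℂ) * f (0, (ν v h : V)) := by
    simp only [amplitude, flipOp, controlled_mulVec_zero, shiftOp_mulVec, embed, ← mul_assoc,
      coinState_mul_self]
    rfl
  rw [h1, Equiv.sum_comp (ν v) fun u : G.neighborSet v => 1 / (d : ℂ) * f (0, (u : V))]
  have h2 : ∀ u, (normAdj G d v u : ℂ) * f (0, u) =
      if G.Adj v u then 1 / (d : ℂ) * f (0, u) else 0 := fun u => by
    rw [normAdj_apply]; split_ifs <;> simp
  simp only [h2, ← Finset.sum_filter]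
  exact (Finset.sum_subtype (Finset.univ.filter fun u => G.Adj v u)
    (p := fun u => u ∈ G.neighborSet v) (fun u => by simp)
    fun u => 1 / (d : ℂ) * f (0, u)).symm

theorem amplitude_flipOp_one (hd : d ≠ 0) (ν : PortLabelling G d) (f : Fin 2 × V → ℂ) (v : V) :
    amplitude ((flipOp ν).mulVec (embed d f)) (1, v) = -f (1, v) := by
  have h0 := sum_coinState_mul_self hd
  have h1 : ∀ h, (flipOp ν).mulVec (embed d f) (1, h, v) = coinState d h * -f (1, v) := by
    intro h
    rw [flipOp, controlled_mulVec_one, Matrix.neg_mulVec, Pi.neg_apply, coinOp_mulVec]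
    simp only [embed, ← mul_assoc, ← Finset.sum_mul, h0]
    rw [mul_assoc _ _ (1 : ℂ), mul_one]
    ring
  simp only [amplitude, h1, ← mul_assoc, ← Finset.sum_mul, h0, one_mul]

end Operators

/-! ### The smallest eigenphase and the final state -/

section Search

variable {V : Type*} [Fintype V] [DecidableEq V] {G : SimpleGraph V} [DecidableRel G.Adj] {d : ℕ}

theorem inv_tan_sq (δ : ℝ) : (Real.tan δ ^ 2)⁻¹ = (Real.cos δ / Real.sin δ) ^ 2 := by
  rw [Real.tan_eq_sin_div_cos, ← inv_pow, inv_div]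

theorem exists_embed_of_fixed (hd : d ≠ 0) {T : Finset V} {δ : ℝ} {y : Fin 2 × Fin d × V → ℂ}
    (hy : (coinReflection d T δ).mulVec y = y) :
    ∃ f : Fin 2 × V → ℂ, y = embed d f ∧ markProj T δ f = 0 := by
  refine ⟨amplitude y - markProj T δ (amplitude y), ?_, ?_⟩
  · rw [coinReflection_mulVec hd, sub_eq_iff_eq_add, ← two_smul ℂ y] at hy
    exact (smul_right_injective _ (two_ne_zero (α := ℂ)) hy).symm
  · have h : ∀ f g : Fin 2 × V → ℂ, markProj T δ (f - g) = markProj T δ f - markProj T δ g := by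
      intro f g
      ext a
      simp only [markProj, Pi.sub_apply, mul_sub, Finset.sum_sub_distrib]
      split_ifs <;> simp
    rw [h, markProj_markProj, sub_self]

omit [Fintype V] in
theorem apply_one_of_markProj_eq_zero {T : Finset V} {δ : ℝ} (hs : Real.sin δ ≠ 0)
    {f : Fin 2 × V → ℂ} (hf : markProj T δ f = 0) {v : V} (hv : v ∈ T) :
    f (1, v) = -((Real.cos δ / Real.sin δ : ℝ) : ℂ) * f (0, v) := by
  have h := congrFun hf (1, v)
  have hs' : (Real.sin δ : ℂ) ≠ 0 := Complex.ofReal_ne_zero.2 hs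
  simp only [markProj, hv, if_true, Fin.sum_univ_two, ancilla, Matrix.cons_val_zero,
    Matrix.cons_val_one, Pi.zero_apply, mul_eq_zero, hs', false_or] at h
  rw [Complex.ofReal_div]
  field_simp
  linear_combination h

/-- No eigenphase of `U_δ` in `(0, π]` has a cosine above the top of the spectrum of the
compressed problem. -/
theorem cos_le_of_mem_eigenphases (hd : d ≠ 0) {T : Finset V} {δ c : ℝ} (hs : Real.sin δ ≠ 0)
    (hc : -1 ≤ c)
    (hmax : ∀ p : V → ℝ, p ⬝ᵥ p + p ⬝ᵥ (normAdj G d).mulVec p ≤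
      (1 + c) * (p ⬝ᵥ p + (Real.tan δ ^ 2)⁻¹ * ∑ v ∈ T, p v ^ 2))
    (ν : PortLabelling G d) {θ : ℝ} (hθ : θ ∈ eigenphases ν T δ) : Real.cos θ ≤ c := by
  obtain ⟨h0, hπ, hev⟩ := hθ
  -- The eigenvalue `-1` need not come from the compressed problem, but its cosine is `-1`.
  rcases hπ.eq_or_lt with rfl | hπ
  · simpa using hc
  obtain ⟨x, hx⟩ := hev.exists_hasEigenvector
  have hxe := hx.apply_eq_smul
  rw [Matrix.toLin'_apply, searchOp_eq hd] at hxe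
  obtain ⟨y, hy0, hRy, hSy⟩ := exists_fixed_of_eigenvector (flipOp_mul_self hd ν)
    (coinReflection_isHermitian hd T δ) (coinReflection_mul_self hd T δ)
    (Real.sin_pos_of_pos_of_lt_pi h0 hπ).ne' hx.2 hxe
  obtain ⟨f, rfl, hf⟩ := exists_embed_of_fixed hd hRy
  rw [star_embed_dotProduct, star_embed_dotProduct, amplitude_embed hd] at hSy
  have hre := congrArg Complex.re hSy
  rw [star_dotProduct_self, ← Complex.ofReal_mul, Complex.ofReal_re, norm_toLp_sq] at hre
  simp only [dotProduct, Fintype.sum_prod_type, Fin.sum_univ_two, amplitude_flipOp_zero,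
    amplitude_flipOp_one hd] at hre
  set p : V → ℝ := fun v => (f (0, v)).re with hp
  set q : V → ℝ := fun v => (f (0, v)).im with hq
  have h1 : (∑ v, star f (0, v) * ∑ u, (normAdj G d v u : ℂ) * f (0, u)).re =
      p ⬝ᵥ (normAdj G d).mulVec p + q ⬝ᵥ (normAdj G d).mulVec q := by
    rw [Complex.re_sum]
    simp only [dotProduct, ← Finset.sum_add_distrib]
    refine Finset.sum_congr rfl fun v _ => ?_
    simp [Complex.mul_re, Complex.re_sum, Complex.im_sum, Matrix.mulVec, dotProduct, hp, hq]
  have h2 : (∑ v, star f (1, v) * -f (1, v)).re = -∑ v, ‖f (1, v)‖ ^ 2 := by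
    rw [Complex.re_sum, ← Finset.sum_neg_distrib]
    refine Finset.sum_congr rfl fun v _ => ?_
    rw [mul_neg, Pi.star_apply, Complex.star_def, Complex.conj_mul', Complex.neg_re,
      ← Complex.ofReal_pow, Complex.ofReal_re]
  have hn : ∀ v, ‖f (0, v)‖ ^ 2 = p v ^ 2 + q v ^ 2 := fun v => by
    rw [← Complex.normSq_eq_norm_sq, Complex.normSq_apply]; simp only [hp, hq]; ring
  have h3 : ∑ v, ‖f (0, v)‖ ^ 2 = p ⬝ᵥ p + q ⬝ᵥ q := by
    simp only [hn, Finset.sum_add_distrib, sum_sq_eq_dotProduct]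
  have h4 : (Real.tan δ ^ 2)⁻¹ * (∑ v ∈ T, p v ^ 2 + ∑ v ∈ T, q v ^ 2) ≤
      ∑ v, ‖f (1, v)‖ ^ 2 := by
    rw [← Finset.sum_add_distrib, Finset.mul_sum]
    refine le_trans (Finset.sum_le_sum fun v hv => ?_)
      (Finset.sum_le_sum_of_subset_of_nonneg (Finset.subset_univ T) fun _ _ _ => sq_nonneg _)
    rw [apply_one_of_markProj_eq_zero hs hf hv, norm_mul, mul_pow, hn, norm_neg,
      Complex.norm_real, inv_tan_sq, Real.norm_eq_abs, sq_abs]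
  have h5 : 0 < ∑ v, ‖f (0, v)‖ ^ 2 + ∑ v, ‖f (1, v)‖ ^ 2 := by
    have h : 0 < ‖WithLp.toLp 2 f‖ ^ 2 := by
      refine pow_pos (norm_pos_iff.2 fun h => hy0 ?_) 2
      have : f = 0 := by simpa using h
      rw [this]; ext x; simp [embed]
    rw [norm_toLp_sq, Fintype.sum_prod_type, Fin.sum_univ_two] at h
    exact h
  rw [Complex.add_re, h1, h2] at hre
  have hmp := hmax p
  have hmq := hmax q
  have h6 : (1 + c) * ((Real.tan δ ^ 2)⁻¹ * (∑ v ∈ T, p v ^ 2 + ∑ v ∈ T, q v ^ 2)) ≤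
      (1 + c) * ∑ v, ‖f (1, v)‖ ^ 2 := mul_le_mul_of_nonneg_left h4 (by linarith)
  rw [h3] at hre h5
  nlinarith

/-- The vector of the compressed problem that belongs to a solution `b` of
`(1 + A) b = (1 + c) (1 + cot² δ 1_T) b`. The state `z` with these amplitudes is
`embed d (groundVec T δ b)`. -/
noncomputable def groundVec (T : Finset V) (δ : ℝ) (b : V → ℝ) : Fin 2 × V → ℂ :=
  fun a => ((![b a.2, if a.2 ∈ T then -(Real.cos δ / Real.sin δ) * b a.2 else 0] a.1 : ℝ) : ℂ)

omit [Fintype V] in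
theorem markProj_groundVec {T : Finset V} {δ : ℝ} (hs : Real.sin δ ≠ 0) (b : V → ℝ) :
    markProj T δ (groundVec T δ b) = 0 := by
  have hs' : (Real.sin δ : ℂ) ≠ 0 := Complex.ofReal_ne_zero.2 hs
  ext a
  by_cases h : a.2 ∈ T
  · simp only [markProj, h, if_true, Fin.sum_univ_two, ancilla, groundVec, Matrix.cons_val_zero,
      Matrix.cons_val_one, Pi.zero_apply]
    push_cast [-Complex.ofReal_cos, -Complex.ofReal_sin]
    field_simp
    ring
  · simp [markProj, h]

theorem coinReflection_groundVec (hd : d ≠ 0) {T : Finset V} {δ : ℝ} (hs : Real.sin δ ≠ 0)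
    (b : V → ℝ) :
    (coinReflection d T δ).mulVec (embed d (groundVec T δ b)) = embed d (groundVec T δ b) := by
  rw [coinReflection_mulVec hd, amplitude_embed hd, markProj_groundVec hs, sub_zero, two_smul,
    add_sub_cancel_right]

theorem amplitude_flipOp_groundVec (hd : d ≠ 0) (ν : PortLabelling G d) (T : Finset V) (δ : ℝ)
    (b : V → ℝ) : amplitude ((flipOp ν).mulVec (embed d (groundVec T δ b))) =
      fun a => ((![(normAdj G d).mulVec b a.2,
        if a.2 ∈ T then Real.cos δ / Real.sin δ * b a.2 else 0] a.1 : ℝ) : ℂ) := by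
  ext ⟨a, v⟩
  fin_cases a
  · simp only [Fin.zero_eta, amplitude_flipOp_zero]
    simp [groundVec, Matrix.mulVec, dotProduct]
  · simp only [Fin.mk_one, amplitude_flipOp_one hd]
    by_cases h : v ∈ T <;> simp [groundVec, h]

variable {T : Finset V} {δ c : ℝ} {b : V → ℝ}

omit [DecidableRel G.Adj] [Fintype V] in
theorem one_add_inv_tan_sq (hs : Real.sin δ ≠ 0) :
    1 + (Real.tan δ ^ 2)⁻¹ = 1 / Real.sin δ ^ 2 := by
  rw [inv_tan_sq]
  field_simp
  exact Real.sin_sq_add_cos_sq δ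

/-- The component of `S̃ z` in the target subspace. -/
theorem markProj_amplitude_flipOp_groundVec (hd : d ≠ 0) (ν : PortLabelling G d)
    (hs : Real.sin δ ≠ 0)
    (hb : ∀ v, b v + (normAdj G d).mulVec b v =
      (1 + c) * (markWeight T (Real.tan δ ^ 2) v * b v)) :
    markProj T δ (amplitude ((flipOp ν).mulVec (embed d (groundVec T δ b)))) =
      fun a => if a.2 ∈ T then
        ancilla δ a.1 * ((Real.cos δ * (1 + c) / Real.sin δ ^ 2 * b a.2 : ℝ) : ℂ) else 0 := by
  ext ⟨a, v⟩
  rw [amplitude_flipOp_groundVec hd]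
  by_cases h : v ∈ T
  · have hbv := hb v
    rw [markWeight, if_pos h, one_add_inv_tan_sq hs] at hbv
    simp only [markProj, h, if_true, Fin.sum_univ_two, Matrix.cons_val_zero,
      Matrix.cons_val_one]
    congr 1
    simp only [ancilla, Matrix.cons_val_zero, Matrix.cons_val_one]
    rw [← Complex.ofReal_mul, ← Complex.ofReal_mul, ← Complex.ofReal_add]
    congr 1
    rw [eq_sub_of_add_eq' hbv]
    field_simp
    ring
  · simp [markProj, h]

/-- `z` is an eigenvector of the compression of `S̃` to the range of the reflection. -/
theorem flipOp_add_coinReflection_groundVec (hd : d ≠ 0) (ν : PortLabelling G d)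
    (hs : Real.sin δ ≠ 0)
    (hb : ∀ v, b v + (normAdj G d).mulVec b v =
      (1 + c) * (markWeight T (Real.tan δ ^ 2) v * b v)) :
    (flipOp ν).mulVec (embed d (groundVec T δ b)) +
      (coinReflection d T δ).mulVec ((flipOp ν).mulVec (embed d (groundVec T δ b))) =
        (2 * (c : ℂ)) • embed d (groundVec T δ b) := by
  have key : amplitude ((flipOp ν).mulVec (embed d (groundVec T δ b))) -
      markProj T δ (amplitude ((flipOp ν).mulVec (embed d (groundVec T δ b)))) =
        (c : ℂ) • groundVec T δ b := by
    rw [markProj_amplitude_flipOp_groundVec hd ν hs hb, amplitude_flipOp_groundVec hd]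
    ext ⟨a, v⟩
    have hbv := hb v
    have hsc := Real.sin_sq_add_cos_sq δ
    by_cases h : v ∈ T
    · rw [markWeight, if_pos h, one_add_inv_tan_sq hs] at hbv
      simp only [Pi.sub_apply, Pi.smul_apply, smul_eq_mul, h, if_true, groundVec]
      fin_cases a
      · simp only [Fin.zero_eta, ancilla, Matrix.cons_val_zero]
        rw [← Complex.ofReal_mul, ← Complex.ofReal_mul, ← Complex.ofReal_sub]
        congr 1
        rw [eq_sub_of_add_eq' hbv]
        field_simp
        linear_combination (-(b v * (1 + c))) * hsc
      · simp only [Fin.mk_one, ancilla, Matrix.cons_val_one, Matrix.cons_val_fin_one]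
        rw [← Complex.ofReal_mul, ← Complex.ofReal_mul, ← Complex.ofReal_sub]
        congr 1
        field_simp
        ring
    · rw [markWeight, if_neg h] at hbv
      have hAv : (normAdj G d).mulVec b v = c * b v := by linarith
      simp only [Pi.sub_apply, Pi.smul_apply, smul_eq_mul, h, if_false, groundVec, sub_zero]
      fin_cases a <;> simp [hAv]
  rw [coinReflection_mulVec hd, key, add_sub_cancel]
  ext x
  simp only [Pi.smul_apply, smul_eq_mul, embed]
  ring

omit [Fintype V] in
theorem embed_groundVec_ne_zero (hd : d ≠ 0) (hb0 : b ≠ 0) : embed d (groundVec T δ b) ≠ 0 := by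
  intro h
  refine hb0 (funext fun v => ?_)
  have h1 := amplitude_embed hd (groundVec T δ b)
  rw [h] at h1
  have h2 := congrFun h1 (0, v)
  simp only [amplitude, groundVec, Pi.zero_apply, mul_zero, Finset.sum_const_zero,
    Matrix.cons_val_zero] at h2
  exact_mod_cast h2.symm

/-- The smallest eigenphase of `U_δ` is `arccos c`. -/
theorem isLeast_eigenphases (hd : d ≠ 0) (ν : PortLabelling G d) (hs : Real.sin δ ≠ 0)
    (hc0 : -1 < c) (hc1 : c < 1) (hb0 : b ≠ 0)
    (hb : ∀ v, b v + (normAdj G d).mulVec b v =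
      (1 + c) * (markWeight T (Real.tan δ ^ 2) v * b v))
    (hmax : ∀ p : V → ℝ, p ⬝ᵥ p + p ⬝ᵥ (normAdj G d).mulVec p ≤
      (1 + c) * (p ⬝ᵥ p + (Real.tan δ ^ 2)⁻¹ * ∑ v ∈ T, p v ^ 2)) :
    IsLeast (eigenphases ν T δ) (Real.arccos c) := by
  have hcos : Real.cos (Real.arccos c) = c := Real.cos_arccos hc0.le hc1.le
  have hpos : 0 < Real.arccos c := Real.arccos_pos.2 hc1
  have hlt : Real.arccos c < Real.pi := Real.arccos_lt_pi.2 hc0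
  refine ⟨⟨hpos, hlt.le, ?_⟩, fun θ hθ => ?_⟩
  · rw [searchOp_eq hd]
    refine hasEigenvalue_of_fixed (flipOp_mul_self hd ν)
      (Real.sin_pos_of_pos_of_lt_pi hpos hlt).ne' (embed_groundVec_ne_zero hd hb0)
      (coinReflection_groundVec hd hs b) ?_
    rw [hcos]
    exact flipOp_add_coinReflection_groundVec hd ν hs hb
  · have h := cos_le_of_mem_eigenphases hd hs hc0.le hmax ν hθ
    rw [← Real.arccos_cos hθ.1.le hθ.2.1]
    exact Real.arccos_le_arccos h

theorem norm_targetProj_mulVec_le (hd : d ≠ 0) (T : Finset V) (δ : ℝ)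
    (y : Fin 2 × Fin d × V → ℂ) :
    ‖WithLp.toLp 2 ((targetProj d T δ).mulVec y)‖ ≤ ‖WithLp.toLp 2 y‖ := by
  have hP := targetProj_isHermitian (d := d) T δ
  -- `1 - 2 P` is an isometry, and `P` is the mean of the identity and of its negative.
  have hI : (1 - (2 : ℂ) • targetProj d T δ).IsHermitian := by
    rw [Matrix.IsHermitian, Matrix.conjTranspose_sub, Matrix.conjTranspose_smul, hP.eq]
    simp
  have hI2 : (1 - (2 : ℂ) • targetProj d T δ) * (1 - (2 : ℂ) • targetProj d T δ) = 1 := by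
    rw [sub_mul, mul_sub, mul_sub, smul_mul_smul_comm, targetProj_mul_self hd]
    simp only [one_mul, mul_one]
    module
  have h1 := norm_mulVec_of_involution hI hI2 y
  have h2 : WithLp.toLp 2 ((targetProj d T δ).mulVec y) = (1 / 2 : ℂ) • (WithLp.toLp 2 y -
      WithLp.toLp 2 ((1 - (2 : ℂ) • targetProj d T δ).mulVec y)) := by
    rw [Matrix.sub_mulVec, Matrix.one_mulVec, Matrix.smul_mulVec, ← WithLp.toLp_sub,
      sub_sub_cancel, ← WithLp.toLp_smul, smul_smul]
    norm_num
  rw [h2, norm_smul]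
  have h3 := norm_sub_le (WithLp.toLp 2 y)
    (WithLp.toLp 2 ((1 - (2 : ℂ) • targetProj d T δ).mulVec y))
  rw [h1] at h3
  have h4 : ‖(1 / 2 : ℂ)‖ = 1 / 2 := by norm_num
  rw [h4]
  linarith

/-- The target states are supported on the marked vertices. -/
theorem targetProb_le_findProb (hd : d ≠ 0) (T : Finset V) (δ : ℝ)
    (y : Fin 2 × Fin d × V → ℂ) : targetProb d T δ y ≤ findProb T y := by
  set w : Fin 2 × Fin d × V → ℂ := fun x => if x.2.2 ∈ T then y x else 0 with hw
  have h1 : (targetProj d T δ).mulVec y = (targetProj d T δ).mulVec w := by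
    rw [targetProj_mulVec, targetProj_mulVec]
    congr 1
    ext a
    by_cases h : a.2 ∈ T <;> simp [markProj, amplitude, hw, h]
  have h2 : findProb T y = ‖WithLp.toLp 2 w‖ ^ 2 := by
    rw [norm_toLp_sq, findProb, Finset.sum_filter]
    refine Finset.sum_congr rfl fun x _ => ?_
    by_cases h : x.2.2 ∈ T <;> simp [hw, h]
  rw [targetProb, h1, h2]
  exact pow_le_pow_left₀ (norm_nonneg _) (norm_targetProj_mulVec_le hd T δ w) 2

omit [DecidableRel G.Adj] in
theorem startState_eq (V : Type*) [Fintype V] [DecidableEq V] (d : ℕ) : startState V d =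
    embed d fun a => ((![1 / √(Fintype.card V), 0] a.1 : ℝ) : ℂ) := by
  ext ⟨a, h, v⟩
  fin_cases a <;>
    simp [startState, embed, ancilla, uniformState, vertexState, mul_comm, Finset.sum_apply,
      Pi.single_apply]

theorem norm_startState [Nonempty V] (hd : d ≠ 0) : ‖WithLp.toLp 2 (startState V d)‖ = 1 := by
  have hN : (0 : ℝ) < Fintype.card V := by exact_mod_cast Fintype.card_pos
  have h := norm_embed_sq hd fun a : Fin 2 × V => ((![1 / √(Fintype.card V), 0] a.1 : ℝ) : ℂ)
  rw [← startState_eq, Fintype.sum_prod_type, Fin.sum_univ_two] at h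
  simp only [Complex.norm_real, Real.norm_eq_abs, sq_abs, Matrix.cons_val_zero,
    Matrix.cons_val_one, Finset.sum_const, Finset.card_univ, nsmul_eq_mul, one_div, inv_pow,
    Real.sq_sqrt hN.le] at h
  rw [mul_inv_cancel₀ hN.ne'] at h
  have : ‖WithLp.toLp 2 (startState V d)‖ ^ 2 = 1 := by rw [h]; simp
  exact (pow_eq_one_iff_of_nonneg (norm_nonneg _) two_ne_zero).1 this

omit [DecidableRel G.Adj] in
theorem findProb_pow_le_one [Nonempty V] (hd : d ≠ 0) (ν : PortLabelling G d) (T : Finset V)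
    (δ : ℝ) (Q : ℕ) : findProb T ((searchOp ν T δ ^ Q).mulVec (startState V d)) ≤ 1 := by
  have h := norm_pow_mulVec (flipOp_isHermitian ν) (flipOp_mul_self hd ν)
    (coinReflection_isHermitian hd T δ) (coinReflection_mul_self hd T δ) Q (startState V d)
  rw [← searchOp_eq hd, norm_startState hd] at h
  rw [← one_pow 2, ← h, norm_toLp_sq, findProb]
  exact Finset.sum_le_sum_of_subset_of_nonneg (Finset.filter_subset _ _) fun _ _ _ => sq_nonneg _

theorem norm_startState_sub_groundVec_sq (hd : d ≠ 0) (T : Finset V) (δ : ℝ) (b : V → ℝ) :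
    ‖WithLp.toLp 2 (startState V d - embed d (groundVec T δ b))‖ ^ 2 =
      ∑ v, (b v - 1 / √(Fintype.card V)) ^ 2 + (Real.tan δ ^ 2)⁻¹ * ∑ v ∈ T, b v ^ 2 := by
  have h1 : startState V d - embed d (groundVec T δ b) =
      embed d fun a => ((![1 / √(Fintype.card V), 0] a.1 : ℝ) : ℂ) - groundVec T δ b a := by
    rw [startState_eq]; ext x; simp only [embed, Pi.sub_apply]; ring
  rw [h1, norm_embed_sq hd, Fintype.sum_prod_type, Fin.sum_univ_two]
  congr 1
  · refine Finset.sum_congr rfl fun v _ => ?_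
    simp only [groundVec, Matrix.cons_val_zero]
    rw [← Complex.ofReal_sub, Complex.norm_real, Real.norm_eq_abs, sq_abs]
    ring
  · rw [inv_tan_sq, Finset.mul_sum, ← Finset.sum_filter_add_sum_filter_not Finset.univ (· ∈ T)]
    have h2 : ∑ v ∈ Finset.univ.filter (· ∉ T), ‖((![1 / √(Fintype.card V), 0] (1, v).1 : ℝ) : ℂ) -
        groundVec T δ b (1, v)‖ ^ 2 = 0 := Finset.sum_eq_zero fun v hv => by
      simp [groundVec, (Finset.mem_filter.1 hv).2]
    rw [h2, add_zero]
    have h3 : Finset.univ.filter (· ∈ T) = T := by ext v; simp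
    rw [h3]
    refine Finset.sum_congr rfl fun v hv => ?_
    simp only [groundVec, Matrix.cons_val_one, Matrix.cons_val_fin_one, hv, if_true]
    rw [← Complex.ofReal_sub, Complex.norm_real, Real.norm_eq_abs, sq_abs]
    ring

/-- The final state, projected on the target subspace, for the starting state `z`. -/
theorem norm_targetProj_pow_groundVec_sq (hd : d ≠ 0) (ν : PortLabelling G d)
    (hs : Real.sin δ ≠ 0)
    (hb : ∀ v, b v + (normAdj G d).mulVec b v =
      (1 + c) * (markWeight T (Real.tan δ ^ 2) v * b v)) {θ : ℝ} (hθ : Real.cos θ = c)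
    (Q : ℕ) :
    Real.sin θ ^ 2 * ‖WithLp.toLp 2 ((targetProj d T δ).mulVec
        ((searchOp ν T δ ^ Q).mulVec (embed d (groundVec T δ b))))‖ ^ 2 =
      Real.sin (Q * θ) ^ 2 *
        ((Real.cos δ * (1 + c) / Real.sin δ ^ 2) ^ 2 * ∑ v ∈ T, b v ^ 2) := by
  have hSz := flipOp_add_coinReflection_groundVec hd ν hs hb
  rw [← hθ] at hSz
  have h1 := sin_smul_pow_mulVec (flipOp_mul_self hd ν) (coinReflection_groundVec hd hs b) hSz Q
  have h2 := congrArg (targetProj d T δ).mulVec h1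
  have h3 : (targetProj d T δ).mulVec (embed d (groundVec T δ b)) = 0 := by
    rw [targetProj_mulVec, amplitude_embed hd, markProj_groundVec hs]
    ext x; simp [embed]
  rw [Matrix.mulVec_smul, Matrix.mulVec_sub, Matrix.mulVec_smul, Matrix.mulVec_smul, h3,
    smul_zero, sub_zero, ← searchOp_eq hd, targetProj_mulVec _ _ ((flipOp ν).mulVec _),
    markProj_amplitude_flipOp_groundVec hd ν hs hb] at h2
  have h4 := congrArg (fun y => ‖WithLp.toLp 2 y‖ ^ 2) h2
  simp only [WithLp.toLp_smul, norm_smul, mul_pow, Complex.norm_real, Real.norm_eq_abs, sq_abs,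
    norm_embed_sq hd] at h4
  rw [h4]
  congr 1
  rw [Finset.mul_sum, Fintype.sum_prod_type_right]
  have h5 : Finset.univ.filter (· ∈ T) = T := by ext v; simp
  rw [← h5, Finset.sum_filter, h5]
  refine Finset.sum_congr rfl fun v _ => ?_
  by_cases h : v ∈ T
  · have hsc := Real.sin_sq_add_cos_sq δ
    simp only [h, if_true, Fin.sum_univ_two, norm_mul, Complex.norm_real, ancilla,
      Matrix.cons_val_zero, Matrix.cons_val_one, mul_pow, Real.norm_eq_abs, sq_abs]
    rw [← add_mul, add_comm (Real.cos δ ^ 2), hsc, one_mul]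
  · simp [h]

end Search

/-! ### Quantitative bounds -/

section Bounds

variable {V : Type*} [Fintype V] [DecidableEq V] {G : SimpleGraph V} [DecidableRel G.Adj] {d : ℕ}

omit [DecidableEq V] in
theorem one_lt_card_and_degree_ne_zero (hreg : G.IsRegularOfDegree d) (hconn : G.Connected)
    {T : Finset V} (hT : T.Nonempty) (h : 2 * (T.card : ℝ) ≤ Fintype.card V) :
    1 < Fintype.card V ∧ d ≠ 0 := by
  have hV : 1 < Fintype.card V := by
    have h1 : 2 * T.card ≤ Fintype.card V := by exact_mod_cast h
    have := hT.card_pos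
    omega
  refine ⟨hV, ?_⟩
  have : Nontrivial V := Fintype.one_lt_card_iff_nontrivial.1 hV
  obtain ⟨v⟩ := hconn.nonempty
  have := hconn.preconnected.degree_pos_of_nontrivial v
  rw [hreg v] at this
  omega

theorem oracleCalls_searchCircuit (Q : ℕ) : oracleCalls (searchCircuit Q) = Q := by
  have h : List.count Gate.oracle iteration = 1 := by decide
  simp [oracleCalls, searchCircuit, List.count_flatten, h]

/-- The number `⌊π / (2 α)⌋` is at least `π / (4 α)`. -/
theorem le_floor_mul {α : ℝ} (h0 : 0 < α) (hα : α ≤ Real.pi / 4) :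
    Real.pi / 4 ≤ (⌊Real.pi / (2 * α)⌋₊ : ℝ) * α := by
  have h2 : Real.pi / (2 * α) < ⌊Real.pi / (2 * α)⌋₊ + 1 := Nat.lt_floor_add_one _
  rw [div_lt_iff₀ (by positivity)] at h2
  linarith

theorem floor_mul_le {α : ℝ} (h0 : 0 < α) :
    (⌊Real.pi / (2 * α)⌋₊ : ℝ) * α ≤ Real.pi / 2 := by
  have h1 : (⌊Real.pi / (2 * α)⌋₊ : ℝ) ≤ Real.pi / (2 * α) :=
    Nat.floor_le (by have := Real.pi_pos; positivity)
  rw [le_div_iff₀ (by positivity)] at h1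
  linarith

theorem half_le_sin_sq {α : ℝ} (h0 : 0 < α) (hα : α ≤ Real.pi / 4) :
    1 / 2 ≤ Real.sin ((⌊Real.pi / (2 * α)⌋₊ : ℝ) * α) ^ 2 := by
  have h5 := Real.sin_le_sin_of_le_of_le_pi_div_two (by linarith [Real.pi_pos])
    (floor_mul_le h0) (le_floor_mul h0 hα)
  rw [Real.sin_pi_div_four] at h5
  have h6 : (√2 / 2) ^ 2 = 1 / 2 := by
    rw [div_pow, Real.sq_sqrt zero_le_two]; norm_num
  rw [← h6]
  exact pow_le_pow_left₀ (by positivity) h5 2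

theorem arccos_sq_bounds {c : ℝ} (hc : -1 ≤ c) (hc1 : c ≤ 1) :
    2 * (1 - c) ≤ Real.arccos c ^ 2 ∧
      2 * Real.arccos c ^ 2 ≤ Real.pi ^ 2 * (1 - c) := by
  have hcos := Real.cos_arccos hc hc1
  have hπ := Real.pi_pos
  constructor
  · have := Real.one_sub_sq_div_two_le_cos (x := Real.arccos c)
    rw [hcos] at this; linarith
  · have h := Real.cos_le_one_sub_mul_cos_sq (x := Real.arccos c)
      (by rw [abs_of_nonneg (Real.arccos_nonneg c)]; exact Real.arccos_le_pi c)
    rw [hcos] at h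
    have h1 : Real.pi ^ 2 * (2 / Real.pi ^ 2 * Real.arccos c ^ 2) = 2 * Real.arccos c ^ 2 := by
      field_simp
    have h2 : Real.pi ^ 2 * (2 / Real.pi ^ 2 * Real.arccos c ^ 2) ≤ Real.pi ^ 2 * (1 - c) := by
      gcongr; linarith
    linarith

/-- The success probability in terms of the estimates for the eigenvector `b`: the starting state
is at distance at most `√ρ / 2` from `z`, and `U_δ ^ Q z` has a component of norm at least `√ρ` in
the target subspace. -/
theorem le_targetProb_of_estimates (hd : d ≠ 0) (ν : PortLabelling G d) {T : Finset V}
    {δ c α g ρ N M : ℝ} {b : V → ℝ} {Q : ℕ} (hs : Real.sin δ ≠ 0) (hk : 0 < Real.tan δ ^ 2)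
    (hb : ∀ v, b v + (normAdj G d).mulVec b v =
      (1 + c) * (markWeight T (Real.tan δ ^ 2) v * b v))
    (hα : Real.cos α = c) (hsin : 1 / 2 ≤ Real.sin (Q * α) ^ 2) (hc0 : 0 ≤ c) (hc1 : c < 1)
    (hM : 0 < M) (hρ0 : 0 ≤ ρ)
    (hρ : ρ * (8 * (Real.tan δ ^ 2 * g + 2)) ≤ Real.tan δ ^ 2 * g) (hg : 0 < g)
    (hlow : g * M ≤ 2 * (Real.tan δ ^ 2 * g + 2) * N * (1 - c))
    (hmass : (Real.tan δ ^ 2 * (1 - c)) ^ 2 * N ≤ (1 + c) ^ 2 * (M * ∑ v ∈ T, b v ^ 2))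
    (hdist : ∑ v, (b v - 1 / √(Fintype.card V)) ^ 2 +
      (Real.tan δ ^ 2)⁻¹ * ∑ v ∈ T, b v ^ 2 ≤ ρ / 4) :
    ρ / 4 ≤ targetProb d T δ ((searchOp ν T δ ^ Q).mulVec (startState V d)) := by
  have hev := norm_targetProj_pow_groundVec_sq hd ν hs hb hα Q
  rw [← norm_startState_sub_groundVec_sq hd] at hdist
  have h2 : Real.sin α ^ 2 = (1 - c) * (1 + c) := by
    rw [Real.sin_sq, hα]; ring
  have h1 : (Real.cos δ * (1 + c) / Real.sin δ ^ 2) ^ 2 =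
      (Real.tan δ ^ 2)⁻¹ * (1 + (Real.tan δ ^ 2)⁻¹) * (1 + c) ^ 2 := by
    rw [one_add_inv_tan_sq hs, inv_tan_sq]
    field_simp
  rw [h1, h2] at hev
  have hsub : ‖WithLp.toLp 2 ((targetProj d T δ).mulVec ((searchOp ν T δ ^ Q).mulVec
      (startState V d - embed d (groundVec T δ b))))‖ ≤
        ‖WithLp.toLp 2 (startState V d - embed d (groundVec T δ b))‖ := by
    refine (norm_targetProj_mulVec_le hd T δ _).trans (le_of_eq ?_)
    rw [searchOp_eq hd]
    exact norm_pow_mulVec (flipOp_isHermitian ν) (flipOp_mul_self hd ν)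
      (coinReflection_isHermitian hd T δ) (coinReflection_mul_self hd T δ) Q _
  rw [targetProb]
  generalize embed d (groundVec T δ b) = z at hev hdist hsub
  generalize searchOp ν T δ ^ Q = U at hev hsub ⊢
  generalize targetProj d T δ = P at hev hsub ⊢
  generalize Real.tan δ ^ 2 = k at hk hρ hlow hmass hev
  have hsplit : WithLp.toLp 2 (P.mulVec (U.mulVec (startState V d))) =
      WithLp.toLp 2 (P.mulVec (U.mulVec z)) +
        WithLp.toLp 2 (P.mulVec (U.mulVec (startState V d - z))) := by
    rw [← WithLp.toLp_add, ← Matrix.mulVec_add, ← Matrix.mulVec_add, add_sub_cancel]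
  have htri := norm_sub_le_norm_add (WithLp.toLp 2 (P.mulVec (U.mulVec z)))
    (WithLp.toLp 2 (P.mulVec (U.mulVec (startState V d - z))))
  rw [← hsplit] at htri
  have ha0 := norm_nonneg (WithLp.toLp 2 (P.mulVec (U.mulVec z)))
  generalize ‖WithLp.toLp 2 (P.mulVec (U.mulVec z))‖ = a at hev htri ha0
  have ha : ρ ≤ a ^ 2 := by
    have hS0 : 0 ≤ ∑ v ∈ T, b v ^ 2 := by positivity
    generalize ∑ v ∈ T, b v ^ 2 = S at hev hmass hS0
    have h3 : k⁻¹ ≤ k⁻¹ * (1 + k⁻¹) := by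
      have : 0 < k⁻¹ * k⁻¹ := by positivity
      linarith
    have hX0 : 0 < 1 - c := by linarith
    have h4 : 1 / 2 * (k⁻¹ * ((k * (1 - c)) ^ 2 * N)) ≤ (1 - c) * (1 + c) * a ^ 2 * M := by
      calc 1 / 2 * (k⁻¹ * ((k * (1 - c)) ^ 2 * N))
          ≤ 1 / 2 * (k⁻¹ * ((1 + c) ^ 2 * (M * S))) := by gcongr
        _ ≤ Real.sin (Q * α) ^ 2 * (k⁻¹ * (1 + k⁻¹) * ((1 + c) ^ 2 * (M * S))) := by
            gcongr
        _ = (1 - c) * (1 + c) * a ^ 2 * M := by rw [hev]; ring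
    have h5 : k * (1 - c) * N ≤ 2 * (1 + c) * a ^ 2 * M := by
      have e : k⁻¹ * ((k * (1 - c)) ^ 2 * N) = (1 - c) * (k * (1 - c) * N) := by
        field_simp
      rw [e] at h4
      refine le_of_mul_le_mul_left ?_ hX0
      linarith
    have h6 : k * (1 - c) * N ≤ 4 * a ^ 2 * M := by
      refine h5.trans ?_
      have : 0 ≤ a ^ 2 * M := by positivity
      nlinarith
    have h7 : k * g * M ≤ 8 * (k * g + 2) * a ^ 2 * M := by
      have h : k * (g * M) ≤ k * (2 * (k * g + 2) * N * (1 - c)) := by gcongr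
      have h' : 2 * (k * g + 2) * (k * (1 - c) * N) ≤ 2 * (k * g + 2) * (4 * a ^ 2 * M) := by
        gcongr
      linarith
    have h8 : k * g ≤ 8 * (k * g + 2) * a ^ 2 := le_of_mul_le_mul_right h7 hM
    have h9 : 0 < 8 * (k * g + 2) := by positivity
    refine le_of_mul_le_mul_right ?_ h9
    linarith
  have e1 : √ρ ≤ a := Real.sqrt_le_iff.2 ⟨ha0, ha⟩
  have e2 : ‖WithLp.toLp 2 (startState V d - z)‖ ≤ √ρ / 2 := by
    refine abs_le_of_sq_le_sq' ?_ (by positivity) |>.2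
    rw [div_pow, Real.sq_sqrt hρ0]
    linarith
  have e3 : √ρ / 2 ≤ ‖WithLp.toLp 2 (P.mulVec (U.mulVec (startState V d)))‖ := by linarith
  have e4 := pow_le_pow_left₀ (by positivity) e3 2
  rw [div_pow, Real.sq_sqrt hρ0] at e4
  linarith

/-- The search on one graph, with explicit constants. With `ρ = K₁ / (8 (K₂ + 2))`, the component
of `U_δ ^ Q z` in the target subspace has norm at least `√ρ`, and the bound `32 M ≤ K₁ ρ N` brings
the starting state within `√ρ / 2` of `z`. -/
theorem search_bounds (hreg : G.IsRegularOfDegree d) (hconn : G.Connected) (ν : PortLabelling G d)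
    {T : Finset V} (hT : T.Nonempty) {δ K₁ K₂ : ℝ} (hK₁ : 0 < K₁)
    (h₁ : K₁ ≤ Real.tan δ ^ 2 * spectralGap G d) (h₂ : Real.tan δ ^ 2 * spectralGap G d ≤ K₂)
    (hM₁ : 2 * (T.card : ℝ) ≤ Fintype.card V)
    (hM₂ : 32 * (T.card : ℝ) ≤ K₁ * (K₁ / (8 * (K₂ + 2))) * Fintype.card V) :
    IsLeast (eigenphases ν T δ) (minPhase ν T δ) ∧
      K₁ / (8 * (K₂ + 2)) / 4 ≤
        targetProb d T δ (run ν T δ (searchCircuit (numIter ν T δ))) ∧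
      targetProb d T δ (run ν T δ (searchCircuit (numIter ν T δ))) ≤
        findProb T (run ν T δ (searchCircuit (numIter ν T δ))) ∧
      findProb T (run ν T δ (searchCircuit (numIter ν T δ))) ≤ 1 ∧
      √K₁ / 4 * √((Fintype.card V : ℝ) / (spectralGap G d * T.card)) ≤ numIter ν T δ ∧
      (numIter ν T δ : ℝ) ≤ Real.pi / 2 * √(K₂ + 2) *
        √((Fintype.card V : ℝ) / (spectralGap G d * T.card)) := by
  obtain ⟨hV, hd⟩ := one_lt_card_and_degree_ne_zero hreg hconn hT hM₁
  obtain ⟨hg0, hg2, -⟩ := spectralGap_spec hreg hd hconn hV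
  have := hconn.nonempty
  have htan : Real.tan δ ≠ 0 := fun h => by
    rw [h, zero_pow two_ne_zero, zero_mul] at h₁; linarith
  have hs : Real.sin δ ≠ 0 := fun h => htan (by rw [Real.tan_eq_sin_div_cos, h, zero_div])
  have hk : 0 < Real.tan δ ^ 2 := by positivity
  have hN : (0 : ℝ) < Fintype.card V := by exact_mod_cast Nat.lt_of_succ_lt hV
  have hM : (0 : ℝ) < T.card := by exact_mod_cast hT.card_pos
  obtain ⟨c, b₀, hb₀, hbe₀, hmax, hup⟩ := exists_ground_state hreg hd T hk
  have hK₂ : 0 < K₂ := by linarith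
  obtain ⟨ρ, hρ⟩ : ∃ ρ, ρ = K₁ / (8 * (K₂ + 2)) := ⟨_, rfl⟩
  rw [← hρ] at hM₂ ⊢
  have hρ0 : 0 < ρ := by rw [hρ]; positivity
  have hρK : ρ * (8 * (K₂ + 2)) = K₁ := by rw [hρ]; field_simp
  have hρ8 : ρ ≤ 1 / 8 := by nlinarith
  have hgM : 0 < spectralGap G d * (T.card : ℝ) := by positivity
  -- The distance of the top of the spectrum from `1` is at most a small multiple of the gap.
  have hX : (1 - c) * (K₁ * Fintype.card V) ≤ 2 * T.card * spectralGap G d := by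
    rcases le_or_gt (1 - c) 0 with h | h
    · have : (1 - c) * (K₁ * Fintype.card V) ≤ 0 :=
        mul_nonpos_of_nonpos_of_nonneg h (by positivity)
      linarith
    · calc (1 - c) * (K₁ * Fintype.card V)
          ≤ (1 - c) * (Real.tan δ ^ 2 * spectralGap G d * Fintype.card V) := by gcongr
        _ = (1 - c) * (Real.tan δ ^ 2 * Fintype.card V) * spectralGap G d := by ring
        _ ≤ 2 * T.card * spectralGap G d := by gcongr
  have hXg : 16 * (1 - c) ≤ ρ * spectralGap G d := by
    have h1 := mul_le_mul_of_nonneg_right hM₂ hg0.le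
    refine le_of_mul_le_mul_right (a := K₁ * Fintype.card V) ?_ (by positivity)
    linarith
  have hX8 : 1 - c ≤ 1 / 8 := by nlinarith
  have hc0 : 0 ≤ c := by linarith
  have hcg : 1 - c ≤ spectralGap G d / 2 := by nlinarith
  obtain ⟨b, hbs, hb⟩ := exists_normalized_eigenvector hreg hd hconn hV hk (by linarith)
    (by linarith) hb₀ hbe₀ (√(Fintype.card V))
  obtain ⟨hlow, herr, hmass⟩ := ground_state_estimates hreg hd hconn hV hk hc0 hcg hbs hb
  have hX0 : 0 < 1 - c := by
    by_contra h
    push Not at h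
    have : 2 * (Real.tan δ ^ 2 * spectralGap G d + 2) * Fintype.card V * (1 - c) ≤ 0 :=
      mul_nonpos_of_nonneg_of_nonpos (by positivity) h
    linarith
  have hlow' : spectralGap G d * T.card ≤ 2 * (K₂ + 2) * Fintype.card V * (1 - c) := by
    refine hlow.trans ?_
    gcongr
  have hleast := isLeast_eigenphases hd ν hs (by linarith) (by linarith) hb₀ hbe₀ hmax
  obtain ⟨hαlow, hαup⟩ := arccos_sq_bounds (c := c) (by linarith) (by linarith)
  have hcos : Real.cos (Real.arccos c) = c := Real.cos_arccos (by linarith) (by linarith)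
  have hα : minPhase ν T δ = Real.arccos c := hleast.csInf_eq
  rw [← hα] at hleast hαlow hαup hcos
  have hα0 : 0 < minPhase ν T δ := hleast.1.1
  have hπ := Real.pi_pos
  have hα4 : minPhase ν T δ ≤ Real.pi / 4 := by
    refine abs_le_of_sq_le_sq' ?_ (by positivity) |>.2
    have : Real.pi ^ 2 * (1 - c) ≤ Real.pi ^ 2 * (1 / 8) := by gcongr
    linarith
  have hQl : Real.pi / 4 ≤ (numIter ν T δ : ℝ) * minPhase ν T δ := le_floor_mul hα0 hα4
  have hQu : (numIter ν T δ : ℝ) * minPhase ν T δ ≤ Real.pi / 2 := floor_mul_le hα0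
  have hsin : 1 / 2 ≤ Real.sin ((numIter ν T δ : ℝ) * minPhase ν T δ) ^ 2 :=
    half_le_sin_sq hα0 hα4
  obtain ⟨Y, hY⟩ : ∃ Y, Y = (Fintype.card V : ℝ) / (spectralGap G d * T.card) := ⟨_, rfl⟩
  have hY0 : 0 ≤ Y := by rw [hY]; exact div_nonneg hN.le hgM.le
  have hYN : Y * (spectralGap G d * T.card) = Fintype.card V := by
    rw [hY, div_mul_cancel₀ _ hgM.ne']
  rw [run_searchCircuit, ← hY]
  refine ⟨hleast, ?_, targetProb_le_findProb hd T δ _, findProb_pow_le_one hd ν T δ _, ?_, ?_⟩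
  · refine le_targetProb_of_estimates hd ν hs hk hb hcos hsin hc0 (by linarith) hM hρ0.le ?_ hg0
      hlow hmass ?_
    · refine le_trans ?_ (hρK.le.trans h₁)
      gcongr
    · refine le_of_mul_le_mul_right (herr.trans ?_) hg0
      linarith
  · -- `Q ≥ π / (4 α)` and `α ≤ π √(g M / (K₁ N))`.
    generalize minPhase ν T δ = α at *
    have h3 : α * (√K₁ * √Y) ≤ Real.pi := by
      refine abs_le_of_sq_le_sq' ?_ hπ.le |>.2
      rw [mul_pow, mul_pow, Real.sq_sqrt hK₁.le, Real.sq_sqrt hY0]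
      have h4 : (1 - c) * (K₁ * Y) ≤ 2 := by
        refine le_of_mul_le_mul_right ?_ hgM
        rw [← hYN] at hX
        linarith
      have h5 : 0 ≤ K₁ * Y := by positivity
      have h6 := mul_le_mul_of_nonneg_right hαup h5
      have h7 := mul_le_mul_of_nonneg_left h4 (sq_nonneg Real.pi)
      linarith
    refine le_of_mul_le_mul_right ?_ hα0
    linarith
  · generalize minPhase ν T δ = α at *
    have h2 : 1 ≤ α * (√(K₂ + 2) * √Y) := by
      refine abs_le_of_sq_le_sq' ?_ (by positivity) |>.2
      rw [mul_pow, mul_pow, Real.sq_sqrt (by positivity), Real.sq_sqrt hY0, one_pow]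
      have h4 : 1 ≤ 2 * (1 - c) * ((K₂ + 2) * Y) := by
        refine le_of_mul_le_mul_right ?_ hgM
        rw [← hYN] at hlow'
        linarith
      refine h4.trans ?_
      gcongr
    refine le_of_mul_le_mul_right (hQu.trans ?_) hα0
    have h3 := mul_le_mul_of_nonneg_left h2 (by positivity : (0 : ℝ) ≤ Real.pi / 2)
    linarith

end Bounds

end GraphSearch

theorem theorem3 {ι : Type*} (l : Filter ι)
    (V : ι → Type*) [∀ i, Fintype (V i)] [∀ i, DecidableEq (V i)]
    (G : ∀ i, SimpleGraph (V i)) [∀ i, DecidableRel (G i).Adj]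
    (d : ι → ℕ) (T : ∀ i, Finset (V i)) (δ : ι → ℝ)
    (ν : ∀ i, PortLabelling (G i) (d i))
    (hconn : ∀ i, (G i).Connected)
    (hreg : ∀ i, (G i).IsRegularOfDegree (d i))
    (hT : ∀ i, (T i).Nonempty)
    (hM : (fun i => ((T i).card : ℝ)) =o[l] (fun i => (Fintype.card (V i) : ℝ)))
    (hδ : (fun i => Real.tan (δ i)) =Θ[l] (fun i => 1 / √(spectralGap (G i) (d i)))) :
    (∀ᶠ i in l, IsLeast (eigenphases (ν i) (T i) (δ i)) (minPhase (ν i) (T i) (δ i))) ∧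
    (fun i => targetProb (d i) (T i) (δ i)
      (run (ν i) (T i) (δ i) (searchCircuit (numIter (ν i) (T i) (δ i)))))
      =Θ[l] (fun _ => (1 : ℝ)) ∧
    (fun i => findProb (T i)
      (run (ν i) (T i) (δ i) (searchCircuit (numIter (ν i) (T i) (δ i)))))
      =Θ[l] (fun _ => (1 : ℝ)) ∧
    (fun i => (oracleCalls (searchCircuit (numIter (ν i) (T i) (δ i))) : ℝ))
      =Θ[l] (fun i => √((Fintype.card (V i) : ℝ) /
        (spectralGap (G i) (d i) * ((T i).card : ℝ)))) := by
  obtain ⟨C₂, hC₂, h₂⟩ := hδ.1.exists_pos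
  obtain ⟨C₁, hC₁, h₁⟩ := hδ.2.exists_pos
  set K₁ : ℝ := (C₁ ^ 2)⁻¹ with hK₁
  set K₂ : ℝ := C₂ ^ 2 with hK₂
  have hK₁0 : 0 < K₁ := by positivity
  set ρ : ℝ := K₁ / (8 * (K₂ + 2)) with hρ
  have hρ0 : 0 < ρ := by positivity
  have hyp : ∀ᶠ i in l, K₁ ≤ Real.tan (δ i) ^ 2 * spectralGap (G i) (d i) ∧
      Real.tan (δ i) ^ 2 * spectralGap (G i) (d i) ≤ K₂ ∧
      2 * ((T i).card : ℝ) ≤ Fintype.card (V i) ∧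
      32 * ((T i).card : ℝ) ≤ K₁ * (K₁ / (8 * (K₂ + 2))) * Fintype.card (V i) := by
    filter_upwards [h₁.bound, h₂.bound, hM.bound (c := 1 / 2) (by norm_num),
      hM.bound (c := K₁ * ρ / 32) (by positivity)] with i hi₁ hi₂ hi₃ hi₄
    rw [Real.norm_natCast, Real.norm_natCast] at hi₃ hi₄
    have hM₁ : 2 * ((T i).card : ℝ) ≤ Fintype.card (V i) := by linarith
    obtain ⟨hV, hd⟩ := one_lt_card_and_degree_ne_zero (hreg i) (hconn i) (hT i) hM₁
    obtain ⟨hg, -, -⟩ := spectralGap_spec (hreg i) hd (hconn i) hV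
    have hn : ‖1 / √(spectralGap (G i) (d i))‖ ^ 2 = (spectralGap (G i) (d i))⁻¹ := by
      rw [Real.norm_eq_abs, sq_abs, div_pow, Real.sq_sqrt hg.le, one_pow, one_div]
    have hi₁' := pow_le_pow_left₀ (norm_nonneg _) hi₁ 2
    have hi₂' := pow_le_pow_left₀ (norm_nonneg _) hi₂ 2
    rw [mul_pow, hn, Real.norm_eq_abs, sq_abs] at hi₁' hi₂'
    refine ⟨?_, ?_, hM₁, by rw [← hρ]; linarith⟩
    · rw [inv_le_iff_one_le_mul₀ hg] at hi₁'
      rw [hK₁, inv_le_iff_one_le_mul₀ (by positivity)]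
      linarith
    · rwa [← div_eq_mul_inv, le_div_iff₀ hg] at hi₂'
  have key := hyp.mono fun i hi => search_bounds (hreg i) (hconn i) (ν i) (hT i) hK₁0 hi.1
    hi.2.1 hi.2.2.1 hi.2.2.2
  have hlow := key.mono fun i hi => hi.2.1
  have hle := key.mono fun i hi => hi.2.2.1
  have hone := key.mono fun i hi => hi.2.2.2.1
  refine ⟨key.mono fun i hi => hi.1, ⟨?_, ?_⟩, ⟨?_, ?_⟩, ?_, ?_⟩
  · refine IsBigO.of_bound 1 ?_
    filter_upwards [hlow, hle, hone] with i a b c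
    rw [Real.norm_of_nonneg (le_trans (by positivity) a)]
    simpa using b.trans c
  · refine IsBigO.of_bound (ρ / 4)⁻¹ ?_
    filter_upwards [hlow] with i a
    rw [Real.norm_of_nonneg (le_trans (by positivity) a), norm_one, ← div_eq_inv_mul,
      one_le_div₀ (by positivity)]
    exact a
  · refine IsBigO.of_bound 1 ?_
    filter_upwards [hlow, hle, hone] with i a b c
    rw [Real.norm_of_nonneg (le_trans (by positivity) (a.trans b))]
    simpa using c
  · refine IsBigO.of_bound (ρ / 4)⁻¹ ?_
    filter_upwards [hlow, hle] with i a b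
    rw [Real.norm_of_nonneg (le_trans (by positivity) (a.trans b)), norm_one, ← div_eq_inv_mul,
      one_le_div₀ (by positivity)]
    exact a.trans b
  · refine IsBigO.of_bound (Real.pi / 2 * √(K₂ + 2)) ?_
    filter_upwards [key] with i hi
    rw [oracleCalls_searchCircuit, Real.norm_natCast, Real.norm_of_nonneg (Real.sqrt_nonneg _)]
    exact hi.2.2.2.2.2
  · refine IsBigO.of_bound (√K₁ / 4)⁻¹ ?_
    filter_upwards [key] with i hi
    rw [oracleCalls_searchCircuit, Real.norm_natCast, Real.norm_of_nonneg (Real.sqrt_nonneg _),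
      le_inv_mul_iff₀ (by positivity)]
    exact hi.2.2.2.2.1
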